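/- Notation. Let $d\ge 1$ and $1\le k<d$. For a linear map $T$ write $s_1(T)\ge s_2(T)\ge\cdots$ for its singular values. Let $\operatorname{PF}(k-1,k+1)$ be the space of partial flags $V_{k-1}\subset V_{k+1}\subseteq\mathbb{R}^d$ with $\dim V_i=i$, and let $m$ be its Haar measure, i.e. the $O(d)$-invariant Borel probability measure. The miniflag of $F=(V_{k-1},V_{k+1})$ is the set $\mathcal F(F)$ of all $k$-dimensional subspaces $V_k$ with $V_{k-1}\subset V_k\subset V_{k+1}$. A matrix $A\in\operatorname{GL}(d,\mathbb{R})$ maps $F$ to $AF=(AV_{k-1},AV_{k+1})$ and induces a map $\mathcal F(F)\to\mathcal F(AF)$, $V_k\mapsto AV_k$. Entropy. If $\eta$ is a probability measure on maps $f\colon X\to Y$ and $\nu$ is a probability measure on $X$, put $\eta*\nu=\int f_*\nu\,d\eta(f)$, $\Phi_\eta(\nu)=\int d_{\mathrm{KL}}(f_*\nu\,|\,\eta*\nu)\,d\eta(f)$ and $h(\eta)=\inf_\nu\Phi_\eta(\nu)\in[0,\infty]$, where $d_{\mathrm{KL}}$ is the Kullback–Leibler divergence and the infimum is over all probability measures $\nu$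 on $X$. Let $\mu$ be a Borel probability measure on $\operatorname{GL}(d,\mathbb{R})$ and $F_1\in\operatorname{PF}(k-1,k+1)$. Let $\bar\mu_{F_1}$ be the distribution of $AF_1$ for $A\sim\mu$, and $\mu_{F_1,F_2}$ the conditional distribution of $A\sim\mu$ given $AF_1=F_2$, viewed as a law of random maps $\mathcal F(F_1)\to\mathcal F(F_2)$. The fiber-averaged push-forward entropy is $$h_{\mathrm{FA}}(F_1,\mu)=\int h(\mu_{F_1,F_2})\,d\bar\mu_{F_1}(F_2)\in[0,\infty].$$ The constant. For $B\in\operatorname{GL}(d,\mathbb{R})$ and subspaces $U\subseteq V$ of $\mathbb{R}^d$ let $V\ominus U=V\cap U^\perp$ and $B|_{V\perp U}=\operatorname{proj}_{BV\ominus BU}\,B\,\operatorname{proj}_{V\ominus U}$, where $\operatorname{proj}_W$ is the orthogonal projection onto $W$. Call $C\in\mathbb{R}$ a gap constant for $d$ if for all $1\le k<d$ and all $B\in\operatorname{GL}(d,\mathbb{R})$ the function under the integral below is $m$-integrable and $$\left|\int_{\operatorname{PF}(k-1,k+1)}\log\frac{s_1(B|_{V_{k+1}\perp V_{k-1}})}{s_2(B|_{V_{k+1}\perp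 V_{k-1}})}\,dm(V_{k-1},V_{k+1})-\log\frac{s_k(B)}{s_{k+1}(B)}\right|\le C.$$ Statement. For every $d$ a gap constant exists, and whenever $C_d$ is a gap constant for $d$, then for all $1\le k<d$ and every Borel probability measure $\mu$ on $\operatorname{GL}(d,\mathbb{R})$, $$\mathbb{E}_\mu\big[\log s_k(A)-\log s_{k+1}(A)\big]\ \ge\ \int_{\operatorname{PF}(k-1,k+1)}h_{\mathrm{FA}}(F,\mu)\,dm(F)-C_d .$$ Both the expectation and the integral of $h_{\mathrm{FA}}$ are integrals of non-negative functions and may be $+\infty$. In particular $C_d$ depends on $d$ only. -/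

import Mathlib

open MeasureTheory ProbabilityTheory InformationTheory Module
open scoped ENNReal

noncomputable section

namespace Miniflag

/-! ### Matrices acting on Euclidean space -/

/-- The linear map of `ℝ^d` given by an invertible matrix. -/
abbrev lin {d : ℕ} (A : GL (Fin d) ℝ) : EuclideanSpace ℝ (Fin d) →ₗ[ℝ] EuclideanSpace ℝ (Fin d) :=
  Matrix.toEuclideanLin (A : Matrix (Fin d) (Fin d) ℝ)

theorem lin_injective {d : ℕ} (A : GL (Fin d) ℝ) : Function.Injective (lin A) := by
  have h : lin A⁻¹ ∘ₗ lin A = LinearMap.id := by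
    rw [← Matrix.toLpLin_mul_same, ← Units.val_mul, inv_mul_cancel, Units.val_one,
      Matrix.toLpLin_one]
  intro x y hxy
  have h' := congrArg (lin A⁻¹) hxy
  rwa [← LinearMap.comp_apply, ← LinearMap.comp_apply, h] at h'

theorem finrank_map_lin {d : ℕ} (A : GL (Fin d) ℝ)
    (V : Submodule ℝ (EuclideanSpace ℝ (Fin d))) : finrank ℝ (V.map (lin A)) = finrank ℝ V :=
  (Submodule.equivMapOfInjective (lin A) (lin_injective A) V).finrank_eq.symm

/-- The `k`-th largest singular value `s_k(T)`, `k = 1, 2, …` (Mathlib counts from `0`). -/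
def sv {d : ℕ} (T : EuclideanSpace ℝ (Fin d) →ₗ[ℝ] EuclideanSpace ℝ (Fin d)) (k : ℕ) : ℝ :=
  T.singularValues (k - 1)

/-- `GL(d, ℝ)` carries its Borel σ-algebra. -/
instance instMeasurableSpaceGL (d : ℕ) : MeasurableSpace (GL (Fin d) ℝ) := borel _

instance instBorelSpaceGL (d : ℕ) : BorelSpace (GL (Fin d) ℝ) := ⟨rfl⟩

theorem isClosedEmbedding_embedProduct (d : ℕ) :
    Topology.IsClosedEmbedding (Units.embedProduct (Matrix (Fin d) (Fin d) ℝ)) := by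
  refine ⟨Units.isEmbedding_embedProduct, ?_⟩
  have h : Set.range (Units.embedProduct (Matrix (Fin d) (Fin d) ℝ)) =
      {p | p.1 * p.2.unop = 1} ∩ {p | p.2.unop * p.1 = 1} := by
    ext p
    constructor
    · rintro ⟨u, rfl⟩
      simp
    · rintro ⟨h1, h2⟩
      exact ⟨⟨p.1, p.2.unop, h1, h2⟩, rfl⟩
  rw [h]
  exact (isClosed_eq (continuous_fst.mul (MulOpposite.continuous_unop.comp continuous_snd))
    continuous_const).inter
    (isClosed_eq ((MulOpposite.continuous_unop.comp continuous_snd).mul continuous_fst)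
    continuous_const)

instance instPolishSpaceGL (d : ℕ) : PolishSpace (GL (Fin d) ℝ) := by
  have : PolishSpace (Matrix (Fin d) (Fin d) ℝ) :=
    inferInstanceAs (PolishSpace (Fin d → Fin d → ℝ))
  have : PolishSpace (Matrix (Fin d) (Fin d) ℝ)ᵐᵒᵖ :=
    (MulOpposite.opHomeomorph (M := Matrix (Fin d) (Fin d) ℝ)).symm.isClosedEmbedding.polishSpace
  exact (isClosedEmbedding_embedProduct d).polishSpace

/-! ### Grassmannians and partial flags -/

/-- The Grassmannian `Gr(k, d)` of `k`-planes in `ℝ^d`. -/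
@[ext] structure Gr (d k : ℕ) where
  space : Submodule ℝ (EuclideanSpace ℝ (Fin d))
  finrank_space : finrank ℝ space = k

/-- The space `PF(i, j)` of partial flags `V_i ⊆ V_j ⊆ ℝ^d` with `dim V_i = i`, `dim V_j = j`. -/
@[ext] structure PF (d i j : ℕ) where
  lo : Submodule ℝ (EuclideanSpace ℝ (Fin d))
  hi : Submodule ℝ (EuclideanSpace ℝ (Fin d))
  finrank_lo : finrank ℝ lo = i
  finrank_hi : finrank ℝ hi = j
  lo_le_hi : lo ≤ hi

/-- The usual topology of the Grassmannian: a subspace is identified with the orthogonal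
projection onto it. -/
instance instTopologicalSpaceGr (d k : ℕ) : TopologicalSpace (Gr d k) :=
  TopologicalSpace.induced (fun V => V.space.starProjection) inferInstance

instance instMeasurableSpaceGr (d k : ℕ) : MeasurableSpace (Gr d k) := borel _

instance instBorelSpaceGr (d k : ℕ) : BorelSpace (Gr d k) := ⟨rfl⟩

/-- The usual topology of the space of partial flags: a flag is identified with the pair of
orthogonal projections onto its two members. -/
instance instTopologicalSpacePF (d i j : ℕ) : TopologicalSpace (PF d i j) :=
  TopologicalSpace.induced (fun F => (F.lo.starProjection, F.hi.starProjection)) inferInstance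

instance instMeasurableSpacePF (d i j : ℕ) : MeasurableSpace (PF d i j) := borel _

instance instBorelSpacePF (d i j : ℕ) : BorelSpace (PF d i j) := ⟨rfl⟩

/-- The image `A V` of a `k`-plane. -/
def Gr.act {d k : ℕ} (A : GL (Fin d) ℝ) (V : Gr d k) : Gr d k where
  space := V.space.map (lin A)
  finrank_space := (finrank_map_lin A V.space).trans V.finrank_space

/-- The image `(A V_i, A V_j)` of a partial flag. -/
def PF.act {d i j : ℕ} (A : GL (Fin d) ℝ) (F : PF d i j) : PF d i j where
  lo := F.lo.map (lin A)
  hi := F.hi.map (lin A)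
  finrank_lo := (finrank_map_lin A F.lo).trans F.finrank_lo
  finrank_hi := (finrank_map_lin A F.hi).trans F.finrank_hi
  lo_le_hi := Submodule.map_mono F.lo_le_hi

theorem pred_le_succ (k : ℕ) : k - 1 ≤ k + 1 := (Nat.sub_le k 1).trans (Nat.le_succ k)

/-- The miniflag `𝓕(V_{k-1}, V_{k+1})`: all `k`-planes `V_k` with `V_{k-1} ⊆ V_k ⊆ V_{k+1}`. -/
def fiber {d k : ℕ} (F : PF d (k - 1) (k + 1)) : Set (Gr d k) :=
  {V | F.lo ≤ V.space ∧ V.space ≤ F.hi}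

/-! ### The Haar measure on partial flags -/

/-- `O(d)` carries its Borel σ-algebra. -/
instance instMeasurableSpaceO (d : ℕ) : MeasurableSpace (Matrix.orthogonalGroup (Fin d) ℝ) :=
  borel _

instance instBorelSpaceO (d : ℕ) : BorelSpace (Matrix.orthogonalGroup (Fin d) ℝ) := ⟨rfl⟩

instance instCompactSpaceO (d : ℕ) : CompactSpace (Matrix.orthogonalGroup (Fin d) ℝ) := by
  have hK : IsCompact (Set.matrix (Metric.closedBall (0 : ℝ) 1) : Set (Matrix (Fin d) (Fin d) ℝ)) :=
    (isCompact_closedBall (0 : ℝ) 1).matrix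
  refine isCompact_iff_compactSpace.mp (hK.of_isClosed_subset isClosed_unitary ?_)
  intro U hU i j
  rw [mem_closedBall_zero_iff]
  exact entry_norm_bound_of_unitary hU i j

/-- The coordinate subspace `lin(e_1, …, e_i)` of `ℝ^d`. -/
def coordSpace (d i : ℕ) : Submodule ℝ (EuclideanSpace ℝ (Fin d)) :=
  Submodule.span ℝ (Set.range fun n : {n : Fin d // (n : ℕ) < i} =>
    EuclideanSpace.single (n : Fin d) (1 : ℝ))

theorem finrank_coordSpace {d i : ℕ} (h : i ≤ d) : finrank ℝ (coordSpace d i) = i := by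
  have hli : LinearIndependent ℝ (fun n : {n : Fin d // (n : ℕ) < i} =>
      EuclideanSpace.single (n : Fin d) (1 : ℝ)) := by
    have h0 := (EuclideanSpace.basisFun (Fin d) ℝ).toBasis.linearIndependent.comp
      (fun n : {n : Fin d // (n : ℕ) < i} => (n : Fin d)) Subtype.val_injective
    simpa [Function.comp_def] using h0
  rw [coordSpace, finrank_span_eq_card hli]
  rw [Fintype.card_congr (β := Fin i)
    ⟨fun n => ⟨n.1, n.2⟩, fun n => ⟨⟨n, n.2.trans_le h⟩, n.2⟩, fun _ => rfl, fun _ => rfl⟩]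
  exact Fintype.card_fin i

theorem coordSpace_mono (d : ℕ) {i j : ℕ} (h : i ≤ j) : coordSpace d i ≤ coordSpace d j := by
  refine Submodule.span_mono ?_
  rintro _ ⟨⟨n, hn⟩, rfl⟩
  exact ⟨⟨n, hn.trans_le h⟩, rfl⟩

/-- The coordinate flag. -/
def coordFlag {d i j : ℕ} (hij : i ≤ j) (hjd : j ≤ d) : PF d i j where
  lo := coordSpace d i
  hi := coordSpace d j
  finrank_lo := finrank_coordSpace (hij.trans hjd)
  finrank_hi := finrank_coordSpace hjd
  lo_le_hi := coordSpace_mono d hij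

/-- The normalized Haar measure on `PF(i, j)`, i.e. its `O(d)`-invariant Borel probability measure:
the image of the normalized Haar measure of `O(d)` under an orbit map `g ↦ g F₀`. -/
def haarPF {d i j : ℕ} (hij : i ≤ j) (hjd : j ≤ d) : Measure (PF d i j) :=
  (Measure.haarMeasure
    (⊤ : TopologicalSpace.PositiveCompacts (Matrix.orthogonalGroup (Fin d) ℝ))).map fun g =>
      PF.act (Unitary.toUnits g) (coordFlag hij hjd)

/-! ### Entropy of a random map

A random map `X → Y` is given by a law `μ` on a parameter space `Ω` and maps `f ω : X → Y`. -/

section Entropy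

variable {Ω X Y : Type*} [MeasurableSpace Ω] [MeasurableSpace X] [MeasurableSpace Y]

/-- The mean push-forward `μ * ν = ∫ (f ω)_* ν dμ(ω)`. -/
def meanPush (f : Ω → X → Y) (μ : Measure Ω) (ν : Measure X) : Measure Y :=
  μ.bind fun ω => ν.map (f ω)

/-- The Furstenberg entropy `Φ_μ(ν) = ∫ d_KL((f ω)_* ν | μ * ν) dμ(ω)`. -/
def furstenbergEntropy (f : Ω → X → Y) (μ : Measure Ω) (ν : Measure X) : ℝ≥0∞ :=
  ∫⁻ ω, klDiv (ν.map (f ω)) (meanPush f μ ν) ∂μ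

/-- The push-forward entropy `h(μ)`: the infimum of `Φ_μ(ν)` over all probability measures `ν`
on `X`. -/
def pushforwardEntropy (f : Ω → X → Y) (μ : Measure Ω) : ℝ≥0∞ :=
  ⨅ ν : ProbabilityMeasure X, furstenbergEntropy f μ (ν : Measure X)

end Entropy

/-- The action of matrices on the points of the miniflag over `F`; the image point lies in the
miniflag over `A F`, which is a subset of `Gr(k, d)`. -/
def fiberMap {d k : ℕ} (F : PF d (k - 1) (k + 1)) (A : GL (Fin d) ℝ) (V : fiber F) : Gr d k :=
  Gr.act A V

theorem fiberMap_mem {d k : ℕ} (F : PF d (k - 1) (k + 1)) (A : GL (Fin d) ℝ) (V : fiber F) :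
    fiberMap F A V ∈ fiber (PF.act A F) :=
  ⟨Submodule.map_mono V.2.1, Submodule.map_mono V.2.2⟩

/-- The conditional distribution `μ_{F₁,F₂}` of `A ∼ μ` given `A F₁ = F₂` (as a function of `F₂`,
defined for almost all `F₂` with respect to the law of `A F₁`). -/
def condLaw {d i j : ℕ} (μ : Measure (GL (Fin d) ℝ)) [IsFiniteMeasure μ] (F₁ F₂ : PF d i j) :
    Measure (GL (Fin d) ℝ) :=
  condDistrib id (fun A : GL (Fin d) ℝ => PF.act A F₁) μ F₂

/-- The fiber-averaged push-forward entropy `h_FA(F₁, μ)`: the mean of `h(μ_{F₁,F₂})` when `F₂`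
is distributed as the image `A F₁`, `A ∼ μ`. -/
def hFA {d k : ℕ} (F₁ : PF d (k - 1) (k + 1)) (μ : Measure (GL (Fin d) ℝ)) [IsFiniteMeasure μ] :
    ℝ≥0∞ :=
  ∫⁻ F₂, pushforwardEntropy (fiberMap F₁) (condLaw μ F₁ F₂) ∂(μ.map fun A => PF.act A F₁)

/-! ### The constant -/

/-- The map `B|_{V ⊥ U} = proj_{B(V) ⊖ B(U)} B proj_{V ⊖ U}` for `(U, V)` a partial flag, where
`V ⊖ U = V ∩ Uᗮ`. -/
def perpMap {d i j : ℕ} (B : GL (Fin d) ℝ) (F : PF d i j) :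
    EuclideanSpace ℝ (Fin d) →ₗ[ℝ] EuclideanSpace ℝ (Fin d) :=
  ((PF.act B F).hi ⊓ (PF.act B F).loᗮ).starProjection.toLinearMap ∘ₗ lin B ∘ₗ
    (F.hi ⊓ F.loᗮ).starProjection.toLinearMap

/-- `C` bounds, for all `1 ≤ k < d` and all `B ∈ GL(d, ℝ)`, the difference between the Haar average
of the logarithmic singular value gap of `B` on `V_{k+1} ⊖ V_{k-1}` and the `k`-th logarithmic
singular value gap of `B`. -/
def IsGapConstant (d : ℕ) (C : ℝ) : Prop :=
  ∀ (k : ℕ) (_ : 1 ≤ k) (hkd : k < d) (B : GL (Fin d) ℝ),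
    Integrable (fun F : PF d (k - 1) (k + 1) => Real.log (sv (perpMap B F) 1 / sv (perpMap B F) 2))
      (haarPF (pred_le_succ k) hkd) ∧
    |∫ F : PF d (k - 1) (k + 1), Real.log (sv (perpMap B F) 1 / sv (perpMap B F) 2)
        ∂(haarPF (pred_le_succ k) hkd) - Real.log (sv (lin B) k / sv (lin B) (k + 1))| ≤ C

end Miniflag

end

open MeasureTheory ProbabilityTheory InformationTheory Module
open scoped ENNReal

noncomputable section

namespace Miniflag

/-! ### Relative entropies with respect to the mean push-forward -/

/-! Entropy bound. The infimum in `pushforwardEntropy` is tested on one measure, the uniform law on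
the directions of the plane V_{k+1} ⊖ V_{k-1}. In orthonormal coordinates A acts on these directions
by a 2×2 map of norm at most s_1 with |det| = s_1 s_2, so the image law is at most s_1/s_2 times the
uniform law on the target miniflag (`map_fiberLaw_le`). For random densities p_ω ≤ c(ω) against a
fixed probability measure, with mean q, the mean divergence from the mean is E∫ p log p − ∫ q log q
≤ E log c, because ∫ q log q ≥ 0 (`lintegral_klDiv_bind_le`). Disintegration over AF = F₂ gives
h_FA(F, μ) ≤ E log(s_1/s_2) (`hFA_le`). Tonelli over the flags and the definition of a gap constant
finish the inequality.

Existence of a gap constant. Let the flag be spanned by columns of a random orthogonal U, let p_m be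
the log of the squared volume of the B-image of the first m columns, and let S_m be the sum of 2 log
s_i(B) over i ≤ m. Then p_{k+1} = p_{k-1} + 2 log s_1 + 2 log s_2 and p_k ≤ p_{k-1} + 2 log s_1 ≤
S_k, with s_1, s_2 taken on the plane. So the gap log(s_1/s_2) lies between p_k − (p_{k-1} +
p_{k+1})/2 and S_k − (p_{k-1} + p_{k+1})/2, whereas S_k − (S_{k-1} + S_{k+1})/2 is exactly
log(s_k(B)/s_{k+1}(B)). By Cauchy–Binet, S_m − p_m is between 0 and log m! − 2 log|minor of LU|,
where the orthogonal matrix L depends on B only. Haar invariance removes L. What remains is the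
integrability of log|minor|, which follows from that of |minor|^{-1/2}
(`lintegral_invSqrt_minor_ne_top`), proved by averaging over plane rotations. -/

/-- This is p log(p/q) ≤ p log c − p log q, with every negative term moved across so that it can be
integrated in [0, ∞] without integrability hypotheses. -/
theorem mul_ofReal_klFun_add_le {p q : ℝ≥0∞} {c : ℝ} (hpc : p ≤ ENNReal.ofReal c) (hq0 : q ≠ 0)
    (hq : q ≠ ∞) :
    q * ENNReal.ofReal (klFun (p / q).toReal) + p + p * ENNReal.ofReal (Real.log q.toReal) ≤
      p * ENNReal.ofReal (Real.log c) + q + p * ENNReal.ofReal (-Real.log q.toReal) := by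
  have hp : p ≠ ∞ := (hpc.trans_lt ENNReal.ofReal_lt_top).ne
  obtain ⟨x, hx, rfl⟩ : ∃ x : ℝ, 0 ≤ x ∧ p = ENNReal.ofReal x :=
    ⟨p.toReal, ENNReal.toReal_nonneg, (ENNReal.ofReal_toReal hp).symm⟩
  obtain ⟨y, hy, rfl⟩ : ∃ y : ℝ, 0 < y ∧ q = ENNReal.ofReal y :=
    ⟨q.toReal, ENNReal.toReal_pos hq0 hq, (ENNReal.ofReal_toReal hq).symm⟩
  rw [ENNReal.toReal_div, ENNReal.toReal_ofReal hx, ENNReal.toReal_ofReal hy.le]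
  have hmax (t : ℝ) : ENNReal.ofReal t = ENNReal.ofReal (max t 0) := by
    simp [ENNReal.ofReal, Real.toNNReal]
  rw [hmax (Real.log y), hmax (Real.log c), hmax (-Real.log y)]
  have hk : 0 ≤ klFun (x / y) := klFun_nonneg (by positivity)
  rw [← ENNReal.ofReal_mul hy.le, ← ENNReal.ofReal_mul hx, ← ENNReal.ofReal_mul hx,
    ← ENNReal.ofReal_mul hx, ← ENNReal.ofReal_add (by positivity) hx,
    ← ENNReal.ofReal_add (by positivity) (by positivity),
    ← ENNReal.ofReal_add (by positivity) (by positivity),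
    ← ENNReal.ofReal_add (by positivity) (by positivity)]
  apply ENNReal.ofReal_le_ofReal
  have hm : max (Real.log y) 0 - max (-Real.log y) 0 = Real.log y := by
    rcases le_total (Real.log y) 0 with h | h
    · rw [max_eq_right h, max_eq_left (by linarith)]; ring
    · rw [max_eq_left h, max_eq_right (by linarith)]; ring
  have hkl : y * klFun (x / y) = x * Real.log (x / y) + y - x := by
    rw [klFun_apply]; field_simp
  rw [hkl]
  rcases hx.eq_or_lt with rfl | hx'
  · simp
  rw [Real.log_div hx'.ne' hy.ne']
  have hc : x ≤ c := by
    rcases le_total c 0 with h | h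
    · rw [ENNReal.ofReal_of_nonpos h] at hpc
      exact absurd (ENNReal.ofReal_eq_zero.mp (le_zero_iff.mp hpc)) (not_le.mpr hx')
    · exact (ENNReal.ofReal_le_ofReal_iff h).mp hpc
  have hl : Real.log x ≤ max (Real.log c) 0 := (Real.log_le_log hx' hc).trans (le_max_left _ _)
  nlinarith [mul_le_mul_of_nonneg_left hl hx]

variable {Ω Y : Type*} [MeasurableSpace Ω] [MeasurableSpace Y]

/-- The content is q − 1 ≤ q log q, the pointwise form of ∫ q log q ≥ 0 over a probability measure.
The two parts of log q sit on opposite sides because L and M may be infinite. -/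
theorem add_le_add_one_of_log {L M q : ℝ≥0∞} (hq0 : q ≠ 0) (hq : q ≠ ∞)
    (h : L + q + q * ENNReal.ofReal (Real.log q.toReal) ≤
      M + q + q * ENNReal.ofReal (-Real.log q.toReal)) : L + q ≤ M + 1 := by
  have hpos : 0 < q.toReal := ENNReal.toReal_pos hq0 hq
  rcases le_total 1 q.toReal with h1 | h1
  · have hl := Real.log_nonneg h1
    rw [ENNReal.ofReal_of_nonpos (p := -Real.log q.toReal) (by linarith), mul_zero, add_zero,
      add_right_comm] at h
    have h' : L + q * ENNReal.ofReal (Real.log q.toReal) ≤ M :=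
      (ENNReal.add_le_add_iff_right hq).mp h
    have h2 : q ≤ q * ENNReal.ofReal (Real.log q.toReal) + 1 := by
      have := Real.one_sub_inv_le_log_of_pos hpos
      nth_rw 1 2 [← ENNReal.ofReal_toReal hq]
      rw [← ENNReal.ofReal_mul hpos.le, ← ENNReal.ofReal_one,
        ← ENNReal.ofReal_add (by positivity) zero_le_one]
      apply ENNReal.ofReal_le_ofReal
      have h3 := mul_le_mul_of_nonneg_left this hpos.le
      rw [mul_sub, mul_inv_cancel₀ hpos.ne'] at h3
      linarith
    calc L + q ≤ L + (q * ENNReal.ofReal (Real.log q.toReal) + 1) := by gcongr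
      _ = L + q * ENNReal.ofReal (Real.log q.toReal) + 1 := (add_assoc _ _ _).symm
      _ ≤ M + 1 := by gcongr
  · have hl := Real.log_nonpos hpos.le h1
    rw [ENNReal.ofReal_of_nonpos hl, mul_zero, add_zero] at h
    refine h.trans ?_
    rw [add_assoc]
    gcongr
    have := Real.one_sub_inv_le_log_of_pos hpos
    nth_rw 1 2 [← ENNReal.ofReal_toReal hq]
    rw [← ENNReal.ofReal_mul hpos.le, ← ENNReal.ofReal_one,
      ← ENNReal.ofReal_add hpos.le (mul_nonneg hpos.le (by linarith))]
    apply ENNReal.ofReal_le_ofReal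
    have h3 := mul_le_mul_of_nonneg_left this hpos.le
    rw [mul_sub, mul_inv_cancel₀ hpos.ne'] at h3
    linarith

theorem klDiv_withDensity_eq {m : Measure Y} {p q : Y → ℝ≥0∞} (hp : Measurable p)
    (hq : Measurable q) [IsFiniteMeasure (m.withDensity p)] [IsFiniteMeasure (m.withDensity q)]
    (hq_top : ∀ᵐ x ∂m, q x ≠ ∞) (hpq : ∀ᵐ x ∂m, q x = 0 → p x = 0) :
    klDiv (m.withDensity p) (m.withDensity q) =
      ∫⁻ x, q x * ENNReal.ofReal (klFun (p x / q x).toReal) ∂m := by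
  have hmul : m.withDensity p = (m.withDensity q).withDensity (fun x => p x / q x) := by
    change _ = (m.withDensity q).withDensity (p / q)
    rw [← withDensity_mul m hq (hp.div hq)]
    refine withDensity_congr_ae ?_
    filter_upwards [hq_top, hpq] with x h1 h2
    by_cases h0 : q x = 0
    · simp [h0, h2 h0]
    · simp only [Pi.mul_apply, Pi.div_apply]
      rw [ENNReal.mul_div_cancel h0 h1]
  have hrn : (m.withDensity p).rnDeriv (m.withDensity q) =ᵐ[m.withDensity q]
      fun x => p x / q x := by
    conv_lhs => rw [hmul]
    exact Measure.rnDeriv_withDensity _ (hp.div hq)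
  have hac : m.withDensity p ≪ m.withDensity q := by
    rw [hmul]; exact withDensity_absolutelyContinuous _ _
  have hk : Measurable fun x => ENNReal.ofReal (klFun (p x / q x).toReal) :=
    (measurable_klFun.comp (hp.div hq).ennreal_toReal).ennreal_ofReal
  rw [klDiv_eq_lintegral_klFun_of_ac hac]
  rw [lintegral_congr_ae (g := fun x => ENNReal.ofReal (klFun (p x / q x).toReal))]
  · rw [lintegral_withDensity_eq_lintegral_mul m hq hk]; rfl
  · filter_upwards [hrn] with x hx
    rw [hx]

theorem lintegral_klDiv_withDensity_le {η : Measure Ω} [IsProbabilityMeasure η] {m : Measure Y}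
    [IsProbabilityMeasure m] {p : Ω → Y → ℝ≥0∞} (hp : Measurable (Function.uncurry p)) {c : Ω → ℝ}
    (hc : Measurable c) (hp1 : ∀ᵐ ω ∂η, ∫⁻ x, p ω x ∂m = 1)
    (hle : ∀ᵐ ω ∂η, ∀ᵐ x ∂m, p ω x ≤ ENNReal.ofReal (c ω)) :
    ∫⁻ ω, klDiv (m.withDensity (p ω)) (m.withDensity fun x => ∫⁻ ω, p ω x ∂η) ∂η ≤
      ∫⁻ ω, ENNReal.ofReal (Real.log (c ω)) ∂η := by
  set q : Y → ℝ≥0∞ := fun x => ∫⁻ ω, p ω x ∂η with hq_def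
  have hpω (ω) : Measurable (p ω) := hp.comp measurable_prodMk_left
  have hpx (x) : Measurable fun ω => p ω x := hp.comp measurable_prodMk_right
  have hq : Measurable q := Measurable.lintegral_prod_left' hp
  have hq1 : ∫⁻ x, q x ∂m = 1 := by
    rw [hq_def, ← lintegral_lintegral_swap hp.aemeasurable, lintegral_congr_ae hp1]; simp
  have hq_top : ∀ᵐ x ∂m, q x ≠ ∞ := by
    filter_upwards [ae_lt_top hq (by rw [hq1]; simp)] with x hx using hx.ne
  have hfq : IsFiniteMeasure (m.withDensity q) :=
    isFiniteMeasure_withDensity (by rw [hq1]; simp)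
  -- Where the mean density vanishes, almost every density does; Fubini exchanges the two
  -- quantifiers.
  have hpq : ∀ᵐ ω ∂η, ∀ᵐ x ∂m, q x = 0 → p ω x = 0 := by
    have hms : MeasurableSet {z : Ω × Y | q z.2 = 0 → p z.1 z.2 = 0} := by
      have h1 : MeasurableSet {z : Ω × Y | q z.2 = 0} :=
        (hq.comp measurable_snd) (measurableSet_singleton 0)
      have h2 : MeasurableSet {z : Ω × Y | p z.1 z.2 = 0} := hp (measurableSet_singleton 0)
      exact MeasurableSet.imp h1 h2
    rw [Measure.ae_ae_comm hms]
    refine Filter.Eventually.of_forall fun x => ?_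
    by_cases h : q x = 0
    · filter_upwards [(lintegral_eq_zero_iff (hpx x)).mp h] with ω hω _ using hω
    · exact Filter.Eventually.of_forall fun ω h' => absurd h' h
  have hle' : ∀ᵐ x ∂m, ∀ᵐ ω ∂η, p ω x ≤ ENNReal.ofReal (c ω) := by
    rw [← Measure.ae_ae_comm (p := fun ω x => p ω x ≤ ENNReal.ofReal (c ω))]
    · exact hle
    · exact measurableSet_le hp (hc.comp measurable_fst).ennreal_ofReal
  have hk : Measurable (Function.uncurry fun ω x =>
      q x * ENNReal.ofReal (klFun (p ω x / q x).toReal)) :=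
    (hq.comp measurable_snd).mul
      (measurable_klFun.comp (hp.div (hq.comp measurable_snd)).ennreal_toReal).ennreal_ofReal
  have hM : Measurable (Function.uncurry fun ω x => p ω x * ENNReal.ofReal (Real.log (c ω))) :=
    hp.mul (Real.measurable_log.comp (hc.comp measurable_fst)).ennreal_ofReal
  have hstep : ∫⁻ ω, klDiv (m.withDensity (p ω)) (m.withDensity q) ∂η =
      ∫⁻ x, ∫⁻ ω, q x * ENNReal.ofReal (klFun (p ω x / q x).toReal) ∂η ∂m := by
    rw [← lintegral_lintegral_swap hk.aemeasurable]
    refine lintegral_congr_ae ?_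
    filter_upwards [hp1, hpq] with ω h1 h2
    have : IsFiniteMeasure (m.withDensity (p ω)) :=
      isFiniteMeasure_withDensity (by rw [h1]; simp)
    exact klDiv_withDensity_eq (hpω ω) hq hq_top h2
  have hpt : ∀ᵐ x ∂m, (∫⁻ ω, q x * ENNReal.ofReal (klFun (p ω x / q x).toReal) ∂η) + q x ≤
      (∫⁻ ω, p ω x * ENNReal.ofReal (Real.log (c ω)) ∂η) + 1 := by
    filter_upwards [hq_top, hle'] with x h1 h2
    by_cases h0 : q x = 0
    · simp [h0]
    refine add_le_add_one_of_log h0 h1 ?_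
    have hkx : Measurable fun ω => q x * ENNReal.ofReal (klFun (p ω x / q x).toReal) :=
      hk.comp measurable_prodMk_right
    have hMx : Measurable fun ω => p ω x * ENNReal.ofReal (Real.log (c ω)) :=
      hM.comp measurable_prodMk_right
    have hmono : ∫⁻ ω, (q x * ENNReal.ofReal (klFun (p ω x / q x).toReal) + p ω x +
        p ω x * ENNReal.ofReal (Real.log (q x).toReal)) ∂η ≤
        ∫⁻ ω, (p ω x * ENNReal.ofReal (Real.log (c ω)) + q x +
          p ω x * ENNReal.ofReal (-Real.log (q x).toReal)) ∂η := by
      refine lintegral_mono_ae ?_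
      filter_upwards [h2] with ω hω using mul_ofReal_klFun_add_le hω h0 h1
    rw [lintegral_add_right _ ((hpx x).mul_const _), lintegral_add_left hkx,
      lintegral_mul_const _ (hpx x), lintegral_add_right _ ((hpx x).mul_const _),
      lintegral_add_left hMx, lintegral_mul_const _ (hpx x), lintegral_const, measure_univ, mul_one] at hmono
    exact hmono
  -- Integrated over x, the summand q on the left and the summand 1 on the right both become 1 and
  -- cancel.
  have hint := lintegral_mono_ae hpt
  rw [lintegral_add_right _ hq, hq1, lintegral_add_right _ measurable_const, lintegral_const,
    measure_univ, mul_one, ENNReal.add_le_add_iff_right ENNReal.one_ne_top] at hint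
  rw [hstep]
  refine hint.trans (le_of_eq ?_)
  rw [← lintegral_lintegral_swap hM.aemeasurable]
  refine lintegral_congr_ae ?_
  filter_upwards [hp1] with ω h1
  rw [lintegral_mul_const _ (hpω ω), h1, one_mul]

/-- If almost every member of a random family of probability measures is bounded by a multiple
`c ω` of a fixed probability measure, then its mean divergence from its average is at most the mean
of `log (c ω)`. -/
theorem lintegral_klDiv_bind_le [MeasurableSpace.CountablyGenerated Y] {η : Measure Ω}
    [IsProbabilityMeasure η] {m : Measure Y} [IsProbabilityMeasure m] (κ : Kernel Ω Y)
    [IsMarkovKernel κ] {c : Ω → ℝ} (hc : Measurable c)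
    (hle : ∀ᵐ ω ∂η, κ ω ≤ ENNReal.ofReal (c ω) • m) :
    ∫⁻ ω, klDiv (κ ω) (η.bind κ) ∂η ≤ ∫⁻ ω, ENNReal.ofReal (Real.log (c ω)) ∂η := by
  -- The kernel derivative is jointly measurable, unlike densities chosen for each ω separately;
  -- this is where countable generation enters.
  set p : Ω → Y → ℝ≥0∞ := κ.rnDeriv (Kernel.const Ω m) with hp_def
  have hp : Measurable (Function.uncurry p) := Kernel.measurable_rnDeriv _ _
  have hpω (ω) : Measurable (p ω) := hp.comp measurable_prodMk_left
  have hκ : ∀ᵐ ω ∂η, κ ω = m.withDensity (p ω) := by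
    filter_upwards [hle] with ω hω
    have hac : κ ω ≪ Kernel.const Ω m ω := by
      rw [Kernel.const_apply]
      exact (Measure.absolutelyContinuous_of_le hω).trans Measure.smul_absolutelyContinuous
    have h := Kernel.withDensity_rnDeriv_eq hac
    rw [Kernel.withDensity_apply _ (Kernel.measurable_rnDeriv _ _), Kernel.const_apply] at h
    exact h.symm
  have hbind : η.bind κ = m.withDensity fun x => ∫⁻ ω, p ω x ∂η := by
    ext s hs
    rw [Measure.bind_apply hs κ.measurable.aemeasurable, withDensity_apply _ hs,
      ← lintegral_lintegral_swap hp.aemeasurable]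
    refine lintegral_congr_ae ?_
    filter_upwards [hκ] with ω hω
    rw [hω, withDensity_apply _ hs]
  have hp1 : ∀ᵐ ω ∂η, ∫⁻ x, p ω x ∂m = 1 := by
    filter_upwards [hκ] with ω hω
    rw [← setLIntegral_univ, ← withDensity_apply _ MeasurableSet.univ, ← hω, measure_univ]
  have hpc : ∀ᵐ ω ∂η, ∀ᵐ x ∂m, p ω x ≤ ENNReal.ofReal (c ω) := by
    filter_upwards [hκ, hle] with ω h1 h2
    refine ae_le_of_forall_setLIntegral_le_of_sigmaFinite (hpω ω) fun s hs _ => ?_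
    rw [← withDensity_apply _ hs, ← h1, lintegral_const, Measure.restrict_apply_univ]
    exact h2 s
  calc ∫⁻ ω, klDiv (κ ω) (η.bind κ) ∂η
      = ∫⁻ ω, klDiv (m.withDensity (p ω)) (m.withDensity fun x => ∫⁻ ω, p ω x ∂η) ∂η := by
        refine lintegral_congr_ae ?_
        filter_upwards [hκ] with ω hω
        rw [← hbind, hω]
    _ ≤ _ := lintegral_klDiv_withDensity_le hp hc hp1 hpc

/-! ### Continuity of the action on subspaces -/

section Projection

variable {E : Type*} [NormedAddCommGroup E] [InnerProductSpace ℝ E] [FiniteDimensional ℝ E]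

/-- `P A* A P + (1 - P)`, which is invertible if `A` is injective. -/
def gramOp (A P : E →L[ℝ] E) : E →L[ℝ] E :=
  P ∘L A.adjoint ∘L A ∘L P + (1 - P)

/-- The orthogonal projection onto `A V`, in terms of `A` and the projection `P` onto `V`. -/
def imageProj (A P : E →L[ℝ] E) : E →L[ℝ] E :=
  A ∘L P ∘L Ring.inverse (gramOp A P) ∘L P ∘L A.adjoint

/-- The quadratic form of the operator is ‖APx‖² + ‖x − Px‖², which is definite when A is injective.
-/
theorem isUnit_gramOp {A : E →L[ℝ] E} (hA : Function.Injective A) (V : Submodule ℝ E) :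
    IsUnit (gramOp A V.starProjection) := by
  have hinj : Function.Injective (gramOp A V.starProjection) := by
    rw [injective_iff_map_eq_zero]
    intro x hx
    have h : inner ℝ (gramOp A V.starProjection x) x =
        ‖A (V.starProjection x)‖ ^ 2 + ‖x - V.starProjection x‖ ^ 2 := by
      have h1 : inner ℝ (x - V.starProjection x) (V.starProjection x) = 0 :=
        V.starProjection_inner_eq_zero _ _ (V.starProjection_apply_mem x)
      have h2 : inner ℝ (x - V.starProjection x) x = ‖x - V.starProjection x‖ ^ 2 := by
        rw [← real_inner_self_eq_norm_sq, inner_sub_right (x - _) x, h1, sub_zero]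
      simp only [gramOp, FunLike.coe_add, Pi.add_apply, ContinuousLinearMap.comp_apply,
        FunLike.coe_sub, Pi.sub_apply, one_apply_eq_self, inner_add_left, h2]
      rw [V.inner_starProjection_left_eq_right, ContinuousLinearMap.adjoint_inner_left,
        real_inner_self_eq_norm_sq]
    rw [hx, inner_zero_left] at h
    have h1 : ‖A (V.starProjection x)‖ = 0 := by 
      nlinarith [sq_nonneg ‖x - V.starProjection x‖, sq_nonneg ‖A (V.starProjection x)‖]
    have h2 : ‖x - V.starProjection x‖ = 0 := by 
      nlinarith [sq_nonneg ‖x - V.starProjection x‖, sq_nonneg ‖A (V.starProjection x)‖]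
    rw [norm_eq_zero] at h1 h2
    rw [(injective_iff_map_eq_zero A).mp hA _ h1, sub_zero] at h2
    exact h2
  rw [ContinuousLinearMap.isUnit_iff_bijective]
  exact ⟨hinj, (LinearMap.injective_iff_surjective
    (f := (gramOp A V.starProjection).toLinearMap)).mp hinj⟩

/-- These are the normal equations: the residual x − APy pairs with Av, v ∈ V, to ⟨y − Py, v⟩ = 0.
The formula makes the projection onto AV continuous in A and P jointly. -/
theorem starProjection_map {A : E →L[ℝ] E} (hA : Function.Injective A) (V : Submodule ℝ E) :
    (V.map A.toLinearMap).starProjection = imageProj A V.starProjection := by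
  ext x
  refine (Submodule.eq_starProjection_of_mem_of_inner_eq_zero ?_ ?_)
  · exact Submodule.mem_map_of_mem (V.starProjection_apply_mem _)
  · rintro _ ⟨v, hv, rfl⟩
    set P := V.starProjection with hP
    set y := Ring.inverse (gramOp A P) (P (A.adjoint x)) with hy
    have hSy : gramOp A P y = P (A.adjoint x) := by
      rw [hy, ← mul_apply_eq_comp, Ring.mul_inverse_cancel _ (isUnit_gramOp hA V)]
      rfl
    have hPv : P v = v := V.starProjection_eq_self_iff.mpr hv
    have hS : P (A.adjoint (A (P y))) = P (A.adjoint x) - (y - P y) := by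
      rw [← hSy]; simp [gramOp]
    change inner ℝ (x - A (P y)) (A v) = 0
    rw [← ContinuousLinearMap.adjoint_inner_left, map_sub, ← hPv,
      ← V.inner_starProjection_left_eq_right, map_sub, ← hP, hS, sub_sub_cancel]
    exact V.starProjection_inner_eq_zero _ _ hv

theorem continuousAt_imageProj {A : E →L[ℝ] E} (hA : Function.Injective A) (V : Submodule ℝ E) :
    ContinuousAt (fun p : (E →L[ℝ] E) × (E →L[ℝ] E) => imageProj p.1 p.2)
      (A, V.starProjection) := by
  have hadj : Continuous fun p : (E →L[ℝ] E) × (E →L[ℝ] E) => p.1.adjoint :=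
    ContinuousLinearMap.adjoint.continuous.comp continuous_fst
  have hS : Continuous fun p : (E →L[ℝ] E) × (E →L[ℝ] E) => gramOp p.1 p.2 :=
    (continuous_snd.clm_comp (hadj.clm_comp (continuous_fst.clm_comp continuous_snd))).add
      (continuous_const.sub continuous_snd)
  have hinv : ContinuousAt (fun p : (E →L[ℝ] E) × (E →L[ℝ] E) => Ring.inverse (gramOp p.1 p.2))
      (A, V.starProjection) := by
    obtain ⟨u, hu⟩ := isUnit_gramOp hA V
    have h : ContinuousAt Ring.inverse (gramOp A V.starProjection) :=
      hu ▸ NormedRing.inverse_continuousAt u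
    exact Filter.Tendsto.comp h (hS.tendsto (A, V.starProjection))
  have h1 : Continuous fun p : (E →L[ℝ] E) × (E →L[ℝ] E) => p.2 ∘L p.1.adjoint :=
    continuous_snd.clm_comp hadj
  have h2 : Continuous fun p : (E →L[ℝ] E) × (E →L[ℝ] E) => p.1 ∘L p.2 :=
    continuous_fst.clm_comp continuous_snd
  have h3 := h2.continuousAt.clm_comp (hinv.clm_comp h1.continuousAt)
  exact h3

theorem starProjection_inf_orthogonal {U V : Submodule ℝ E} (h : U ≤ V) :
    (V ⊓ Uᗮ).starProjection = V.starProjection - U.starProjection := by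
  ext x
  refine Submodule.eq_starProjection_of_mem_of_inner_eq_zero (Submodule.mem_inf.mpr ⟨?_, ?_⟩) ?_
  · exact V.sub_mem (V.starProjection_apply_mem x) (h (U.starProjection_apply_mem x))
  · rw [Submodule.mem_orthogonal']
    intro u hu
    have h1 := V.starProjection_inner_eq_zero x u (h hu)
    have h2 := U.starProjection_inner_eq_zero x u hu
    simp only [FunLike.coe_sub, Pi.sub_apply, inner_sub_left] at *
    linarith
  · intro w hw
    have h1 := V.starProjection_inner_eq_zero x w hw.1
    have h2 := Submodule.inner_right_of_mem_orthogonal (U.starProjection_apply_mem x) hw.2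
    simp only [FunLike.coe_sub, Pi.sub_apply, inner_sub_left] at *
    linarith

end Projection

/-- `lin A` as a continuous linear map. -/
def clm {d : ℕ} (A : GL (Fin d) ℝ) : EuclideanSpace ℝ (Fin d) →L[ℝ] EuclideanSpace ℝ (Fin d) :=
  (lin A).toContinuousLinearMap

theorem clm_injective {d : ℕ} (A : GL (Fin d) ℝ) : Function.Injective (clm A) := lin_injective A

theorem continuous_clm (d : ℕ) : Continuous (clm (d := d)) := by
  have h : Continuous ((LinearMap.toContinuousLinearMap.toLinearMap ∘ₗ
      Matrix.toEuclideanLin.toLinearMap :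
        Matrix (Fin d) (Fin d) ℝ →ₗ[ℝ] EuclideanSpace ℝ (Fin d) →L[ℝ] EuclideanSpace ℝ (Fin d))) :=
    LinearMap.continuous_of_finiteDimensional _
  exact h.comp Units.continuous_val

theorem starProjection_map_lin {d : ℕ} (A : GL (Fin d) ℝ)
    (V : Submodule ℝ (EuclideanSpace ℝ (Fin d))) :
    (V.map (lin A)).starProjection = imageProj (clm A) V.starProjection :=
  starProjection_map (clm_injective A) V

theorem continuous_starProjection_map {d : ℕ} {X : Type*} [TopologicalSpace X]
    {V : X → Submodule ℝ (EuclideanSpace ℝ (Fin d))}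
    (hV : Continuous fun x => (V x).starProjection) :
    Continuous fun p : GL (Fin d) ℝ × X => ((V p.2).map (lin p.1)).starProjection := by
  simp_rw [starProjection_map_lin]
  rw [continuous_iff_continuousAt]
  intro p
  exact ContinuousAt.comp (f := fun p : GL (Fin d) ℝ × X => (clm p.1, (V p.2).starProjection))
    (continuousAt_imageProj (clm_injective p.1) (V p.2))
    (((continuous_clm d).comp continuous_fst).prodMk (hV.comp continuous_snd)).continuousAt

theorem Gr.continuous_starProjection {d k : ℕ} :
    Continuous fun V : Gr d k => V.space.starProjection :=
  continuous_induced_dom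

theorem PF.continuous_lo {d i j : ℕ} : Continuous fun F : PF d i j => F.lo.starProjection :=
  continuous_fst.comp
    (continuous_induced_dom (f := fun F : PF d i j => (F.lo.starProjection, F.hi.starProjection)))

theorem PF.continuous_hi {d i j : ℕ} : Continuous fun F : PF d i j => F.hi.starProjection :=
  continuous_snd.comp
    (continuous_induced_dom (f := fun F : PF d i j => (F.lo.starProjection, F.hi.starProjection)))

theorem Gr.continuous_act {d k : ℕ} :
    Continuous fun p : GL (Fin d) ℝ × Gr d k => Gr.act p.1 p.2 :=
  continuous_induced_rng.mpr (continuous_starProjection_map Gr.continuous_starProjection)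

theorem PF.continuous_act {d i j : ℕ} :
    Continuous fun p : GL (Fin d) ℝ × PF d i j => PF.act p.1 p.2 :=
  continuous_induced_rng.mpr ((continuous_starProjection_map PF.continuous_lo).prodMk
    (continuous_starProjection_map PF.continuous_hi))

instance (d k : ℕ) : SecondCountableTopology (Gr d k) :=
  Topology.IsInducing.secondCountableTopology (f := fun V : Gr d k => V.space.starProjection) ⟨rfl⟩

instance (d i j : ℕ) : SecondCountableTopology (PF d i j) :=
  Topology.IsInducing.secondCountableTopology
    (f := fun F : PF d i j => (F.lo.starProjection, F.hi.starProjection)) ⟨rfl⟩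

/-- A subspace is the range of its projection, so the defining map is injective. Separation makes
the event AF = F₂ measurable, which the disintegration needs. -/
instance (d i j : ℕ) : T2Space (PF d i j) :=
  T2Space.of_injective_continuous
    (f := fun F : PF d i j => (F.lo.starProjection, F.hi.starProjection))
    (fun F G h => by
      have h1 := congrArg Prod.fst h
      have h2 := congrArg Prod.snd h
      have h1' := congrArg (fun T => LinearMap.range (ContinuousLinearMap.toLinearMap T)) h1
      have h2' := congrArg (fun T => LinearMap.range (ContinuousLinearMap.toLinearMap T)) h2
      simp only [Submodule.range_starProjection] at h1' h2'
      exact PF.ext h1' h2')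
    continuous_induced_dom

theorem measurable_act_right {d i j : ℕ} (F : PF d i j) :
    Measurable fun A : GL (Fin d) ℝ => PF.act A F :=
  (PF.continuous_act.comp (continuous_id.prodMk continuous_const)).measurable

theorem continuous_toUnits (d : ℕ) :
    Continuous fun g : Matrix.orthogonalGroup (Fin d) ℝ => (Unitary.toUnits g : GL (Fin d) ℝ) := by
  rw [Units.continuous_iff]
  refine ⟨continuous_subtype_val, ?_⟩
  exact (continuous_subtype_val.star :
    Continuous fun g : Matrix.orthogonalGroup (Fin d) ℝ => star (g : Matrix (Fin d) (Fin d) ℝ))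

theorem measurable_orbit {d i j : ℕ} (F : PF d i j) :
    Measurable fun g : Matrix.orthogonalGroup (Fin d) ℝ => PF.act (Unitary.toUnits g) F :=
  (PF.continuous_act.comp ((continuous_toUnits d).prodMk continuous_const)).measurable

/-! ### Continuity of `B|_{V ⊥ U}` -/

/-- `perpMap` as a continuous linear map. -/
def perpCLM {d i j : ℕ} (B : GL (Fin d) ℝ) (F : PF d i j) :
    EuclideanSpace ℝ (Fin d) →L[ℝ] EuclideanSpace ℝ (Fin d) :=
  ((PF.act B F).hi ⊓ (PF.act B F).loᗮ).starProjection ∘L clm B ∘L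
    (F.hi ⊓ F.loᗮ).starProjection

theorem continuous_perpCLM {d i j : ℕ} :
    Continuous fun p : GL (Fin d) ℝ × PF d i j => perpCLM p.1 p.2 := by
  have h (p : GL (Fin d) ℝ × PF d i j) : perpCLM p.1 p.2 =
      ((PF.act p.1 p.2).hi.starProjection - (PF.act p.1 p.2).lo.starProjection) ∘L clm p.1 ∘L
        (p.2.hi.starProjection - p.2.lo.starProjection) := by
    rw [perpCLM, starProjection_inf_orthogonal (PF.act p.1 p.2).lo_le_hi,
      starProjection_inf_orthogonal p.2.lo_le_hi]
  simp_rw [h]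
  exact ((PF.continuous_hi.comp PF.continuous_act).sub
    (PF.continuous_lo.comp PF.continuous_act)).clm_comp
      (((continuous_clm d).comp continuous_fst).clm_comp
        ((PF.continuous_hi.comp continuous_snd).sub (PF.continuous_lo.comp continuous_snd)))

/-! ### Singular values -/

section SingularValues

variable {d : ℕ} (T : EuclideanSpace ℝ (Fin d) →ₗ[ℝ] EuclideanSpace ℝ (Fin d))

theorem sv_nonneg (k : ℕ) : 0 ≤ sv T k := T.singularValues_nonneg _

theorem sv_antitone : Antitone (sv T) := fun _ _ h =>
  T.singularValues_antitone (Nat.sub_le_sub_right h 1)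

/-- An orthonormal basis of right singular vectors. -/
def svBasis : OrthonormalBasis (Fin d) ℝ (EuclideanSpace ℝ (Fin d)) :=
  T.isSymmetric_adjoint_comp_self.eigenvectorBasis finrank_euclideanSpace_fin

theorem adjoint_apply_svBasis (i : Fin d) :
    (LinearMap.adjoint T ∘ₗ T) (svBasis T i) = sv T (i + 1) ^ 2 • svBasis T i := by
  have h := T.isSymmetric_adjoint_comp_self.apply_eigenvectorBasis finrank_euclideanSpace_fin i
  rw [← LinearMap.sq_singularValues_fin T finrank_euclideanSpace_fin i] at h
  exact h

theorem inner_map_map (x y : EuclideanSpace ℝ (Fin d)) :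
    inner ℝ (T x) (T y) =
      ∑ i : Fin d, sv T (i + 1) ^ 2 * inner ℝ x (svBasis T i) * inner ℝ (svBasis T i) y := by
  rw [← LinearMap.adjoint_inner_right, ← LinearMap.comp_apply,
    ← (svBasis T).sum_inner_mul_inner]
  refine Finset.sum_congr rfl fun i _ => ?_
  rw [← T.isSymmetric_adjoint_comp_self, adjoint_apply_svBasis, inner_smul_left]
  simp only [conj_trivial]
  ring

theorem norm_map_le (x : EuclideanSpace ℝ (Fin d)) : ‖T x‖ ≤ sv T 1 * ‖x‖ := by
  refine le_of_sq_le_sq ?_ (mul_nonneg (sv_nonneg T 1) (norm_nonneg x))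
  rw [← real_inner_self_eq_norm_sq, inner_map_map, mul_pow, ← (svBasis T).sum_sq_inner_right x,
    Finset.mul_sum]
  refine Finset.sum_le_sum fun i _ => ?_
  rw [real_inner_comm x, mul_assoc, ← sq]
  exact mul_le_mul_of_nonneg_right
    (pow_le_pow_left₀ (sv_nonneg T _) (sv_antitone T (by omega)) 2) (sq_nonneg _)

theorem norm_map_svBasis (i : Fin d) : ‖T (svBasis T i)‖ = sv T (i + 1) := by
  have h : ‖T (svBasis T i)‖ ^ 2 = sv T (i + 1) ^ 2 := by
    rw [← real_inner_self_eq_norm_sq, ← LinearMap.adjoint_inner_right, ← LinearMap.comp_apply,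
      adjoint_apply_svBasis, inner_smul_right, real_inner_self_eq_norm_sq,
      (svBasis T).norm_eq_one]
    simp
  exact (sq_eq_sq₀ (norm_nonneg _) (sv_nonneg T _)).mp h

theorem trace_adjoint_comp_self :
    LinearMap.trace ℝ _ (LinearMap.adjoint T ∘ₗ T) = ∑ i : Fin d, sv T (i + 1) ^ 2 := by
  rw [LinearMap.trace_eq_sum_inner _ (svBasis T)]
  refine Finset.sum_congr rfl fun i _ => ?_
  rw [adjoint_apply_svBasis, inner_smul_right, real_inner_self_eq_norm_sq,
    (svBasis T).norm_eq_one]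
  simp

theorem trace_adjoint_comp_self_sq :
    LinearMap.trace ℝ _ ((LinearMap.adjoint T ∘ₗ T) ∘ₗ (LinearMap.adjoint T ∘ₗ T)) =
      ∑ i : Fin d, sv T (i + 1) ^ 4 := by
  rw [LinearMap.trace_eq_sum_inner _ (svBasis T)]
  refine Finset.sum_congr rfl fun i _ => ?_
  rw [LinearMap.comp_apply, adjoint_apply_svBasis, map_smul, adjoint_apply_svBasis,
    inner_smul_right, inner_smul_right, real_inner_self_eq_norm_sq, (svBasis T).norm_eq_one]
  ring

theorem sum_sv_pow (hd : 2 ≤ d) (hT : finrank ℝ T.range ≤ 2) {n : ℕ} (hn : n ≠ 0) :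
    ∑ i : Fin d, sv T (i + 1) ^ n = sv T 1 ^ n + sv T 2 ^ n := by
  rw [Fin.sum_univ_eq_sum_range fun i => sv T (i + 1) ^ n, ← Finset.sum_subset
    (s₁ := Finset.range 2) (by simpa using hd)]
  · rw [Finset.sum_range_succ, Finset.sum_range_one]
  · intro i _ hi
    have : sv T (i + 1) = 0 :=
      T.singularValues_eq_zero_iff_le_finrank_range.mpr 
      (hT.trans (not_lt.mp fun h => hi (Finset.mem_range.mpr h)))
    rw [this, zero_pow hn]

/-- In rank at most two, s_1² and s_2² solve a quadratic equation determined by the traces of S*S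
and (S*S)², which are continuous; the root of its discriminant is s_1² − s_2². -/
theorem measurable_sv_div {X : Type*} [MeasurableSpace X] [TopologicalSpace X]
    [OpensMeasurableSpace X] {S : X → EuclideanSpace ℝ (Fin d) →L[ℝ] EuclideanSpace ℝ (Fin d)}
    (hS : Continuous S) (hd : 2 ≤ d) (h2 : ∀ x, finrank ℝ (S x).toLinearMap.range ≤ 2) :
    Measurable fun x => sv (S x).toLinearMap 1 / sv (S x).toLinearMap 2 := by
  set t : (EuclideanSpace ℝ (Fin d) →L[ℝ] EuclideanSpace ℝ (Fin d)) → ℝ := fun R =>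
    LinearMap.trace ℝ _ R.toLinearMap with ht_def
  have ht : Continuous t := by
    have : Continuous (LinearMap.trace ℝ (EuclideanSpace ℝ (Fin d)) ∘ₗ
        (LinearMap.toContinuousLinearMap (𝕜 := ℝ) (E := EuclideanSpace ℝ (Fin d))
          (F' := EuclideanSpace ℝ (Fin d))).symm.toLinearMap) :=
      LinearMap.continuous_of_finiteDimensional _
    exact this
  have hA : Continuous fun x => (S x).adjoint ∘L S x :=
    (ContinuousLinearMap.adjoint.continuous.comp hS).clm_comp hS
  have h1 : Continuous fun x => t ((S x).adjoint ∘L S x) := ht.comp hA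
  have h3 : Continuous fun x => t (((S x).adjoint ∘L S x) ∘L ((S x).adjoint ∘L S x)) :=
    ht.comp (hA.clm_comp hA)
  have e1 (x) : t ((S x).adjoint ∘L S x) = sv (S x).toLinearMap 1 ^ 2 + sv (S x).toLinearMap 2 ^ 2 := by
    rw [← sum_sv_pow _ hd (h2 x) two_ne_zero, ← trace_adjoint_comp_self]; rfl
  have e3 (x) : t (((S x).adjoint ∘L S x) ∘L ((S x).adjoint ∘L S x)) =
      sv (S x).toLinearMap 1 ^ 4 + sv (S x).toLinearMap 2 ^ 4 := by
    rw [← sum_sv_pow _ hd (h2 x) four_ne_zero, ← trace_adjoint_comp_self_sq]; rfl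
  set D : X → ℝ := fun x => √(2 * t (((S x).adjoint ∘L S x) ∘L ((S x).adjoint ∘L S x)) -
    t ((S x).adjoint ∘L S x) ^ 2) with hD
  have eD (x) : D x = sv (S x).toLinearMap 1 ^ 2 - sv (S x).toLinearMap 2 ^ 2 := by
    rw [hD]
    simp only
    rw [e1, e3, show 2 * (sv (S x).toLinearMap 1 ^ 4 + sv (S x).toLinearMap 2 ^ 4) -
      (sv (S x).toLinearMap 1 ^ 2 + sv (S x).toLinearMap 2 ^ 2) ^ 2 =
      (sv (S x).toLinearMap 1 ^ 2 - sv (S x).toLinearMap 2 ^ 2) ^ 2 by ring, Real.sqrt_sq]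
    exact sub_nonneg.mpr (pow_le_pow_left₀ (sv_nonneg _ _) (sv_antitone _ one_le_two) 2)
  have f1 (x) : sv (S x).toLinearMap 1 = √((t ((S x).adjoint ∘L S x) + D x) / 2) := by
    rw [e1, eD, ← Real.sqrt_sq (sv_nonneg (S x).toLinearMap 1)]
    congr 1
    rw [Real.sqrt_sq (sv_nonneg (S x).toLinearMap 1)]; ring
  have f2 (x) : sv (S x).toLinearMap 2 = √((t ((S x).adjoint ∘L S x) - D x) / 2) := by
    rw [e1, eD, ← Real.sqrt_sq (sv_nonneg (S x).toLinearMap 2)]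
    congr 1
    rw [Real.sqrt_sq (sv_nonneg (S x).toLinearMap 2)]; ring
  have hDc : Continuous D := ((continuous_const.mul h3).sub (h1.pow 2)).sqrt
  simp_rw [f1, f2]
  exact ((h1.add hDc).div_const 2).sqrt.measurable.div
    ((h1.sub hDc).div_const 2).sqrt.measurable

/-- Singular values of a map that factors through the projection to a plane. -/
theorem sv_of_plane {e : Fin 2 → EuclideanSpace ℝ (Fin d)} (he : Orthonormal ℝ e)
    (hT : ∀ x, T x = inner ℝ (e 0) x • T (e 0) + inner ℝ (e 1) x • T (e 1)) :
    2 ≤ d ∧ finrank ℝ T.range ≤ 2 ∧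
    sv T 1 ^ 2 * sv T 2 ^ 2 =
      ‖T (e 0)‖ ^ 2 * ‖T (e 1)‖ ^ 2 - inner ℝ (T (e 0)) (T (e 1)) ^ 2 := by
  have hd : 2 ≤ d := by
    simpa using he.linearIndependent.fintype_card_le_finrank
  have hr : finrank ℝ T.range ≤ 2 := by
    have hle : T.range ≤ Submodule.span ℝ (Set.range (T ∘ e)) := by
      rintro _ ⟨x, rfl⟩
      rw [hT x]
      exact Submodule.add_mem _
        (Submodule.smul_mem _ _ (Submodule.subset_span ⟨0, rfl⟩))
        (Submodule.smul_mem _ _ (Submodule.subset_span ⟨1, rfl⟩))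
    refine (Submodule.finrank_mono hle).trans ?_
    exact (finrank_range_le_card (R := ℝ) (T ∘ e)).trans (by simp)
  refine ⟨hd, hr, ?_⟩
  set S := LinearMap.adjoint T ∘ₗ T with hS
  have hSx (x y) : inner ℝ (S x) y = inner ℝ (T x) (T y) := by
    rw [hS, LinearMap.comp_apply, LinearMap.adjoint_inner_left]
  have hSe (x) : S x = inner ℝ (T (e 0)) (T x) • e 0 + inner ℝ (T (e 1)) (T x) • e 1 := by
    refine ext_inner_right ℝ fun y => ?_
    rw [hSx, hT y, inner_add_right, inner_smul_right, inner_smul_right, inner_add_left,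
      inner_smul_left, inner_smul_left, real_inner_comm (T x), real_inner_comm (T x)]
    simp only [conj_trivial]
    ring
  have htr (R : EuclideanSpace ℝ (Fin d) →ₗ[ℝ] EuclideanSpace ℝ (Fin d))
      (u v : EuclideanSpace ℝ (Fin d))
      (hR : ∀ x, R x = inner ℝ u x • e 0 + inner ℝ v x • e 1) :
      LinearMap.trace ℝ _ R = inner ℝ u (e 0) + inner ℝ v (e 1) := by
    have : R = (InnerProductSpace.rankOne ℝ (e 0) u).toLinearMap +
        (InnerProductSpace.rankOne ℝ (e 1) v).toLinearMap := by
      ext1 x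
      simp [hR]
    rw [this, map_add, InnerProductSpace.trace_rankOne, InnerProductSpace.trace_rankOne]
  have h1 := trace_adjoint_comp_self T
  have h2 := trace_adjoint_comp_self_sq T
  rw [sum_sv_pow T hd hr two_ne_zero, ← hS] at h1
  rw [sum_sv_pow T hd hr four_ne_zero, ← hS] at h2
  rw [htr S (S (e 0)) (S (e 1)) (fun x => by rw [hSe x, hSx, hSx]), hSx, hSx,
    real_inner_self_eq_norm_sq, real_inner_self_eq_norm_sq] at h1
  have hsym (x y) : inner ℝ (S x) y = inner ℝ x (S y) := T.isSymmetric_adjoint_comp_self x y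
  rw [htr (S ∘ₗ S) (S (S (e 0))) (S (S (e 1))) (fun x => by
    rw [LinearMap.comp_apply, hSe (S x), ← hSx, ← hSx, hsym (S (e 0)), hsym (S (e 1)), hsym (e 0),
      hsym (e 1)]), hsym (S (e 0)), hsym (S (e 1))] at h2
  have i0 : inner ℝ (e 0) (e 1) = 0 := he.2 (by simp)
  have hn (i) : inner ℝ (S (e i)) (S (e i)) =
      inner ℝ (T (e 0)) (T (e i)) ^ 2 + inner ℝ (T (e 1)) (T (e i)) ^ 2 := by
    rw [hSe (e i)]
    simp only [inner_add_left, inner_add_right, inner_smul_left, inner_smul_right, i0,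
      real_inner_comm (e 0) (e 1), real_inner_self_eq_norm_sq, he.1, conj_trivial]
    ring
  rw [hn, hn, real_inner_self_eq_norm_sq, real_inner_self_eq_norm_sq,
    real_inner_comm (T (e 0)) (T (e 1))] at h2
  -- Both sides are half of (trace)² − (trace of the square), read once from the singular values and
  -- once from the 2×2 Gram matrix.
  linear_combination (1 / 2) * h2 - (1 / 2) * h1 * (sv T 1 ^ 2 + sv T 2 ^ 2 + ‖T (e 0)‖ ^ 2 +
    ‖T (e 1)‖ ^ 2)

end SingularValues

/-! ### The plane `V_{k+1} ⊖ V_{k-1}` and the miniflag -/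

/-- The orthogonal complement `V_j ⊖ V_i` of a partial flag. -/
abbrev PF.diff {d i j : ℕ} (F : PF d i j) : Submodule ℝ (EuclideanSpace ℝ (Fin d)) :=
  F.hi ⊓ F.loᗮ

theorem PF.finrank_diff {d i j : ℕ} (F : PF d i j) : i + finrank ℝ F.diff = j := by
  have h := Submodule.finrank_add_inf_finrank_orthogonal F.lo_le_hi
  rw [F.finrank_lo, F.finrank_hi, inf_comm] at h
  exact h

theorem PF.finrank_diff_eq_two {d k : ℕ} (hk : 1 ≤ k) (F : PF d (k - 1) (k + 1)) :
    finrank ℝ F.diff = 2 := by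
  have := F.finrank_diff
  omega

/-- An orthonormal basis of `V_{k+1} ⊖ V_{k-1}`. -/
def PF.planeBasis {d k : ℕ} (hk : 1 ≤ k) (F : PF d (k - 1) (k + 1)) :
    OrthonormalBasis (Fin 2) ℝ F.diff :=
  (stdOrthonormalBasis ℝ F.diff).reindex (finCongr (F.finrank_diff_eq_two hk))

theorem perpMap_apply {d i j : ℕ} (B : GL (Fin d) ℝ) (F : PF d i j)
    (x : EuclideanSpace ℝ (Fin d)) :
    perpMap B F x = (PF.act B F).diff.starProjection (lin B (F.diff.starProjection x)) := rfl

theorem perpMap_of_mem {d i j : ℕ} (B : GL (Fin d) ℝ) (F : PF d i j)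
    {x : EuclideanSpace ℝ (Fin d)} (hx : x ∈ F.diff) :
    perpMap B F x = (PF.act B F).diff.starProjection (lin B x) := by
  rw [perpMap_apply, F.diff.starProjection_eq_self_iff.mpr hx]

theorem perpMap_eq_plane {d i j : ℕ} (B : GL (Fin d) ℝ) (F : PF d i j)
    (b : OrthonormalBasis (Fin 2) ℝ F.diff) (x : EuclideanSpace ℝ (Fin d)) :
    perpMap B F x = inner ℝ (b 0 : EuclideanSpace ℝ (Fin d)) x • perpMap B F (b 0) +
      inner ℝ (b 1 : EuclideanSpace ℝ (Fin d)) x • perpMap B F (b 1) := by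
  rw [perpMap_of_mem B F (b 0).2, perpMap_of_mem B F (b 1).2, perpMap_apply,
    b.starProjection_eq_sum_rankOne]
  simp [Fin.sum_univ_two]

theorem PF.planeBasis_orthonormal {d k : ℕ} (hk : 1 ≤ k) (F : PF d (k - 1) (k + 1)) :
    Orthonormal ℝ (fun i => (F.planeBasis hk i : EuclideanSpace ℝ (Fin d))) :=
  (F.planeBasis hk).orthonormal.comp_linearIsometry F.diff.subtypeₗᵢ

theorem measurable_sv_div_perpMap {d k : ℕ} (hk : 1 ≤ k) (hkd : k < d) :
    Measurable fun p : GL (Fin d) ℝ × PF d (k - 1) (k + 1) =>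
      sv (perpMap p.1 p.2) 1 / sv (perpMap p.1 p.2) 2 := by
  have hF (B : GL (Fin d) ℝ) (F : PF d (k - 1) (k + 1)) :=
    sv_of_plane (perpMap B F) (F.planeBasis_orthonormal hk)
      (perpMap_eq_plane B F (F.planeBasis hk))
  exact measurable_sv_div
    (S := fun p : GL (Fin d) ℝ × PF d (k - 1) (k + 1) => perpCLM p.1 p.2) continuous_perpCLM
    (by omega) fun p => (hF p.1 p.2).2.1

/-- The parametrization of the plane `V_{k+1} ⊖ V_{k-1}` by `ℝ²`. -/
def PF.planeIso {d k : ℕ} (hk : 1 ≤ k) (F : PF d (k - 1) (k + 1)) :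
    EuclideanSpace ℝ (Fin 2) →ₗᵢ[ℝ] EuclideanSpace ℝ (Fin d) :=
  F.diff.subtypeₗᵢ.comp (F.planeBasis hk).repr.symm.toLinearIsometry

theorem PF.planeIso_mem {d k : ℕ} (hk : 1 ≤ k) (F : PF d (k - 1) (k + 1))
    (x : EuclideanSpace ℝ (Fin 2)) : F.planeIso hk x ∈ F.diff :=
  ((F.planeBasis hk).repr.symm x).2

theorem PF.planeIso_single {d k : ℕ} (hk : 1 ≤ k) (F : PF d (k - 1) (k + 1)) (i : Fin 2) :
    F.planeIso hk (EuclideanSpace.single i 1) = F.planeBasis hk i := by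
  simp [PF.planeIso]

/-- The action of `B` on the planes `V_{k+1} ⊖ V_{k-1}` in the coordinates `planeIso`. -/
def planeMap {d k : ℕ} (hk : 1 ≤ k) (B : GL (Fin d) ℝ) (F : PF d (k - 1) (k + 1)) :
    EuclideanSpace ℝ (Fin 2) →ₗ[ℝ] EuclideanSpace ℝ (Fin 2) :=
  ((PF.act B F).planeBasis hk).repr.toLinearEquiv.toLinearMap ∘ₗ
    (PF.act B F).diff.orthogonalProjectionOnto.toLinearMap ∘ₗ lin B ∘ₗ (F.planeIso hk).toLinearMap

theorem planeIso_planeMap {d k : ℕ} (hk : 1 ≤ k) (B : GL (Fin d) ℝ) (F : PF d (k - 1) (k + 1))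
    (x : EuclideanSpace ℝ (Fin 2)) :
    (PF.act B F).planeIso hk (planeMap hk B F x) = perpMap B F (F.planeIso hk x) := by
  rw [perpMap_of_mem B F (F.planeIso_mem hk x)]
  simp [planeMap, PF.planeIso]

theorem norm_planeMap_le {d k : ℕ} (hk : 1 ≤ k) (B : GL (Fin d) ℝ) (F : PF d (k - 1) (k + 1))
    (x : EuclideanSpace ℝ (Fin 2)) : ‖planeMap hk B F x‖ ≤ sv (perpMap B F) 1 * ‖x‖ := by
  rw [← ((PF.act B F).planeIso hk).norm_map, planeIso_planeMap, ← (F.planeIso hk).norm_map x]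
  exact norm_map_le _ _

/-- The squares of both sides equal the Gram determinant of the images of the plane's basis vectors.
-/
theorem abs_det_planeMap {d k : ℕ} (hk : 1 ≤ k) (B : GL (Fin d) ℝ) (F : PF d (k - 1) (k + 1)) :
    |LinearMap.det (planeMap hk B F)| = sv (perpMap B F) 1 * sv (perpMap B F) 2 := by
  have h := (sv_of_plane (perpMap B F) (F.planeBasis_orthonormal hk)
      (perpMap_eq_plane B F (F.planeBasis hk))).2.2
  simp only [← PF.planeIso_single, ← planeIso_planeMap, LinearIsometry.norm_map,
    LinearIsometry.inner_map_map] at h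
  have hdet : LinearMap.det (planeMap hk B F) ^ 2 =
      (sv (perpMap B F) 1 * sv (perpMap B F) 2) ^ 2 := by
    rw [mul_pow, h, ← LinearMap.det_toMatrix (EuclideanSpace.basisFun (Fin 2) ℝ).toBasis,
      Matrix.det_fin_two, EuclideanSpace.real_norm_sq_eq, EuclideanSpace.real_norm_sq_eq,
      PiLp.inner_apply]
    simp [LinearMap.toMatrix_apply, Fin.sum_univ_two]
    ring
  rw [← Real.sqrt_sq_eq_abs, hdet, Real.sqrt_sq (mul_nonneg (sv_nonneg _ _) (sv_nonneg _ _))]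

theorem sub_starProjection_diff_mem {d i j : ℕ} (F : PF d i j) {x : EuclideanSpace ℝ (Fin d)}
    (hx : x ∈ F.hi) : x - F.diff.starProjection x ∈ F.lo := by
  rw [starProjection_inf_orthogonal F.lo_le_hi, FunLike.coe_sub, Pi.sub_apply,
    F.hi.starProjection_eq_self_iff.mpr hx, sub_sub_cancel]
  exact F.lo.starProjection_apply_mem x

theorem eq_zero_of_mem_lo_of_mem_diff {d i j : ℕ} (F : PF d i j) {x : EuclideanSpace ℝ (Fin d)}
    (h1 : x ∈ F.lo) (h2 : x ∈ F.diff) : x = 0 :=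
  inner_self_eq_zero.mp (Submodule.inner_right_of_mem_orthogonal (𝕜 := ℝ) h1 h2.2)

/-- If the component of Bw in the image plane vanishes, then Bw ∈ BV_{k-1}, so w lies in V_{k-1} and
in its orthogonal complement. -/
theorem planeMap_ne_zero {d k : ℕ} (hk : 1 ≤ k) (B : GL (Fin d) ℝ) (F : PF d (k - 1) (k + 1))
    {x : EuclideanSpace ℝ (Fin 2)} (hx : x ≠ 0) : planeMap hk B F x ≠ 0 := by
  intro h
  have hmem := F.planeIso_mem hk x
  have h0 : perpMap B F (F.planeIso hk x) = 0 := by rw [← planeIso_planeMap, h, map_zero]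
  rw [perpMap_of_mem B F hmem] at h0
  have h1 := sub_starProjection_diff_mem (PF.act B F)
    (show lin B (F.planeIso hk x) ∈ (PF.act B F).hi from Submodule.mem_map_of_mem hmem.1)
  rw [h0, sub_zero] at h1
  obtain ⟨y, hy, hyx⟩ := h1
  rw [lin_injective B hyx] at hy
  have := eq_zero_of_mem_lo_of_mem_diff F hy hmem
  rw [← map_zero (F.planeIso hk)] at this
  exact hx ((F.planeIso hk).injective this)

theorem sv_perpMap_pos {d k : ℕ} (hk : 1 ≤ k) (B : GL (Fin d) ℝ) (F : PF d (k - 1) (k + 1)) :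
    0 < sv (perpMap B F) 1 ∧ 0 < sv (perpMap B F) 2 := by
  have hdet : LinearMap.det (planeMap hk B F) ≠ 0 := by
    intro h
    obtain ⟨x, hx, hx0⟩ := LinearMap.bot_lt_ker_of_det_eq_zero h |>.ne' |>
      (Submodule.ne_bot_iff _).mp
    exact planeMap_ne_zero hk B F hx0 hx
  have h := abs_pos.mpr hdet
  rw [abs_det_planeMap] at h
  have h1 := sv_nonneg (perpMap B F) 1
  have h2 := sv_nonneg (perpMap B F) 2
  exact ⟨h1.lt_of_ne' (left_ne_zero_of_mul h.ne'), h2.lt_of_ne' (right_ne_zero_of_mul h.ne')⟩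

/-- The vector with coordinates `x` in `V_{k+1} ⊖ V_{k-1}`, or a default vector if `x = 0`. -/
def PF.direction {d k : ℕ} (hk : 1 ≤ k) (F : PF d (k - 1) (k + 1))
    (x : EuclideanSpace ℝ (Fin 2)) : EuclideanSpace ℝ (Fin d) :=
  open Classical in
  F.planeIso hk (if x = 0 then EuclideanSpace.single 0 1 else x)

theorem PF.direction_of_ne {d k : ℕ} (hk : 1 ≤ k) (F : PF d (k - 1) (k + 1))
    {x : EuclideanSpace ℝ (Fin 2)} (hx : x ≠ 0) : F.direction hk x = F.planeIso hk x := by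
  rw [PF.direction, if_neg hx]

theorem PF.direction_mem {d k : ℕ} (hk : 1 ≤ k) (F : PF d (k - 1) (k + 1))
    (x : EuclideanSpace ℝ (Fin 2)) : F.direction hk x ∈ F.diff :=
  F.planeIso_mem hk _

theorem PF.direction_ne_zero {d k : ℕ} (hk : 1 ≤ k) (F : PF d (k - 1) (k + 1))
    (x : EuclideanSpace ℝ (Fin 2)) : F.direction hk x ≠ 0 := by
  rw [PF.direction]
  rw [← map_zero (F.planeIso hk)]
  refine (F.planeIso hk).injective.ne ?_
  split_ifs with h
  · simp
  · exact h

theorem measurable_direction {d k : ℕ} (hk : 1 ≤ k) (F : PF d (k - 1) (k + 1)) :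
    Measurable (F.direction hk) :=
  (F.planeIso hk).continuous.measurable.comp
    (Measurable.ite (measurableSet_singleton 0) measurable_const measurable_id)

/-- The point `V_{k-1} + ℝ x` of the miniflag. -/
def PF.line {d k : ℕ} (hk : 1 ≤ k) (F : PF d (k - 1) (k + 1))
    (x : EuclideanSpace ℝ (Fin 2)) : Gr d k where
  space := F.lo ⊔ Submodule.span ℝ {F.direction hk x}
  finrank_space := by
    have h := Submodule.finrank_sup_add_finrank_inf_eq F.lo
      (Submodule.span ℝ {F.direction hk x})
    have h0 : F.lo ⊓ Submodule.span ℝ {F.direction hk x} = ⊥ := by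
      rw [Submodule.eq_bot_iff]
      rintro y ⟨hy1, hy2⟩
      exact eq_zero_of_mem_lo_of_mem_diff F hy1
        ((Submodule.span_singleton_le_iff_mem _ _).mpr (F.direction_mem hk x) hy2)
    rw [h0, finrank_bot, finrank_span_singleton (F.direction_ne_zero hk x), F.finrank_lo] at h
    omega

theorem PF.line_mem_fiber {d k : ℕ} (hk : 1 ≤ k) (F : PF d (k - 1) (k + 1))
    (x : EuclideanSpace ℝ (Fin 2)) : F.line hk x ∈ fiber F :=
  ⟨le_sup_left, sup_le F.lo_le_hi
    ((Submodule.span_singleton_le_iff_mem _ _).mpr (F.direction_mem hk x).1)⟩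

theorem starProjection_sup_span_singleton {E : Type*} [NormedAddCommGroup E]
    [InnerProductSpace ℝ E] [FiniteDimensional ℝ E] {U : Submodule ℝ E} {w : E} (hw : w ∈ Uᗮ)
    (hw0 : w ≠ 0) : (U ⊔ Submodule.span ℝ {w}).starProjection =
      U.starProjection + (‖w‖ ^ 2)⁻¹ • InnerProductSpace.rankOne ℝ w w := by
  have hn : ‖w‖ ^ 2 ≠ 0 := pow_ne_zero 2 (norm_ne_zero_iff.mpr hw0)
  ext1 x
  have hval : (U.starProjection + (‖w‖ ^ 2)⁻¹ • InnerProductSpace.rankOne ℝ w w) x =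
      U.starProjection x + ((‖w‖ ^ 2)⁻¹ * inner ℝ w x) • w := by
    simp [mul_smul]
  rw [hval]
  have hUw : inner ℝ (U.starProjection x) w = 0 :=
    Submodule.inner_right_of_mem_orthogonal (U.starProjection_apply_mem x) hw
  refine Submodule.eq_starProjection_of_mem_of_inner_eq_zero ?_ ?_
  · exact Submodule.add_mem_sup (U.starProjection_apply_mem x)
      (Submodule.smul_mem _ _ (Submodule.mem_span_singleton_self w))
  · intro y hy
    obtain ⟨u, hu, v, hv, rfl⟩ := Submodule.mem_sup.mp hy
    obtain ⟨c, rfl⟩ := Submodule.mem_span_singleton.mp hv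
    have h1 := U.starProjection_inner_eq_zero x u hu
    have h2 : inner ℝ w u = 0 := Submodule.inner_left_of_mem_orthogonal hu hw
    simp only [inner_sub_left] at h1
    simp only [inner_sub_left, inner_add_left, inner_add_right, inner_smul_left, inner_smul_right,
      hUw, h2, conj_trivial, real_inner_self_eq_norm_sq, real_inner_comm x w]
    field_simp
    linear_combination ‖w‖ ^ 2 * h1

/-- The projection onto the k-plane is that onto V_{k-1} plus a rank-one projection depending
measurably on x, and the Borel σ-algebra of `Gr` is pulled back along projections. -/
theorem measurable_line {d k : ℕ} (hk : 1 ≤ k) (F : PF d (k - 1) (k + 1)) :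
    Measurable (F.line hk) := by
  have hm : instMeasurableSpaceGr d k = MeasurableSpace.comap
      (fun V : Gr d k => V.space.starProjection) (borel _) := borel_comap
  have hg : Measurable fun x => (F.line hk x).space.starProjection := by
    have h (x) : (F.line hk x).space.starProjection = F.lo.starProjection +
        (‖F.direction hk x‖ ^ 2)⁻¹ •
          InnerProductSpace.rankOne ℝ (F.direction hk x) (F.direction hk x) :=
      starProjection_sup_span_singleton (F.direction_mem hk x).2 (F.direction_ne_zero hk x)
    simp_rw [h]
    have hr : Continuous fun w : EuclideanSpace ℝ (Fin d) => InnerProductSpace.rankOne ℝ w w :=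
      (InnerProductSpace.rankOne ℝ).continuous.clm_apply continuous_id
    exact measurable_const.add
      ((((measurable_direction hk F).norm.pow_const 2).inv).smul
        (hr.measurable.comp (measurable_direction hk F)))
  rw [hm]
  exact measurable_comap_iff.mpr hg

/-- The vector Bw and its component `perpMap B F w` differ by an element of BV_{k-1}, which the sum
with BV_{k-1} absorbs. -/
theorem act_line {d k : ℕ} (hk : 1 ≤ k) (B : GL (Fin d) ℝ) (F : PF d (k - 1) (k + 1))
    {x : EuclideanSpace ℝ (Fin 2)} (hx : x ≠ 0) :
    Gr.act B (F.line hk x) = (PF.act B F).line hk (planeMap hk B F x) := by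
  ext1
  have hmem := F.planeIso_mem hk x
  have hsub : lin B (F.planeIso hk x) - perpMap B F (F.planeIso hk x) ∈ (PF.act B F).lo := by
    rw [perpMap_of_mem B F hmem]
    exact sub_starProjection_diff_mem (PF.act B F) (Submodule.mem_map_of_mem hmem.1)
  change (F.lo ⊔ Submodule.span ℝ {F.direction hk x}).map (lin B) =
    (PF.act B F).lo ⊔ Submodule.span ℝ {(PF.act B F).direction hk (planeMap hk B F x)}
  rw [F.direction_of_ne hk hx, (PF.act B F).direction_of_ne hk (planeMap_ne_zero hk B F hx),
    planeIso_planeMap, Submodule.map_sup, Submodule.map_span, Set.image_singleton]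
  change (PF.act B F).lo ⊔ _ = _
  apply le_antisymm
  · refine sup_le le_sup_left ((Submodule.span_singleton_le_iff_mem _ _).mpr ?_)
    rw [← sub_add_cancel (lin B (F.planeIso hk x)) (perpMap B F (F.planeIso hk x))]
    exact Submodule.add_mem_sup hsub (Submodule.mem_span_singleton_self _)
  · refine sup_le le_sup_left ((Submodule.span_singleton_le_iff_mem _ _).mpr ?_)
    rw [← sub_sub_cancel (lin B (F.planeIso hk x)) (perpMap B F (F.planeIso hk x)), sub_eq_neg_add]
    exact Submodule.add_mem_sup (neg_mem hsub) (Submodule.mem_span_singleton_self _)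

theorem line_smul {d k : ℕ} (hk : 1 ≤ k) (F : PF d (k - 1) (k + 1)) {r : ℝ} (hr : r ≠ 0)
    {x : EuclideanSpace ℝ (Fin 2)} (hx : x ≠ 0) : F.line hk (r • x) = F.line hk x := by
  ext1
  change F.lo ⊔ Submodule.span ℝ {F.direction hk (r • x)} =
    F.lo ⊔ Submodule.span ℝ {F.direction hk x}
  rw [F.direction_of_ne hk hx, F.direction_of_ne hk (smul_ne_zero hr hx), map_smul,
    Submodule.span_singleton_smul_eq hr.isUnit]

/-! ### The uniform law on a miniflag and its distortion -/

/-- The uniform law on the unit disc. -/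
def discLaw : Measure (EuclideanSpace ℝ (Fin 2)) :=
  cond volume (Metric.ball 0 1)

instance : IsProbabilityMeasure discLaw :=
  cond_isProbabilityMeasure_of_finite (Metric.measure_ball_pos volume _ one_pos).ne'
    measure_ball_lt_top.ne

theorem discLaw_apply (S : Set (EuclideanSpace ℝ (Fin 2))) :
    discLaw S = (volume (Metric.ball (0 : EuclideanSpace ℝ (Fin 2)) 1))⁻¹ *
      volume (Metric.ball 0 1 ∩ S) :=
  cond_apply measurableSet_ball _ _

theorem discLaw_singleton_zero : discLaw {0} = 0 := by
  rw [discLaw_apply, measure_mono_null Set.inter_subset_right (measure_singleton 0), mul_zero]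

-- T sends the unit ball into the ball of radius s. If Z is stable under division by s, the points
-- of the ball landing in Z lie in T⁻¹(s(ball ∩ Z)), whose volume is s²/|det T| times that of ball ∩
-- Z.
open scoped Pointwise in
theorem discLaw_preimage_le {T : EuclideanSpace ℝ (Fin 2) →ₗ[ℝ] EuclideanSpace ℝ (Fin 2)} {s : ℝ}
    (hs : 0 < s) (hT : LinearMap.det T ≠ 0) (hTs : ∀ x, ‖T x‖ ≤ s * ‖x‖)
    {Z : Set (EuclideanSpace ℝ (Fin 2))} (hZ : ∀ y ∈ Z, s⁻¹ • y ∈ Z) :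
    discLaw (T ⁻¹' Z) ≤ ENNReal.ofReal (s ^ 2 / |LinearMap.det T|) * discLaw Z := by
  have hsub : Metric.ball 0 1 ∩ T ⁻¹' Z ⊆ T ⁻¹' (s • (Metric.ball 0 1 ∩ Z)) := by
    rintro x ⟨hx, hxZ⟩
    rw [Set.mem_preimage, Set.mem_smul_set_iff_inv_smul_mem₀ hs.ne']
    refine ⟨?_, hZ _ hxZ⟩
    rw [mem_ball_zero_iff] at hx ⊢
    rw [norm_smul, norm_inv, Real.norm_of_nonneg hs.le, inv_mul_lt_iff₀ hs]
    exact (hTs x).trans_lt (by gcongr)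
  have h2 : finrank ℝ (EuclideanSpace ℝ (Fin 2)) = 2 := finrank_euclideanSpace_fin
  have h := measure_mono (μ := volume) hsub
  rw [Measure.addHaar_preimage_linearMap _ hT, Measure.addHaar_smul, h2, ← mul_assoc,
    ← ENNReal.ofReal_mul (abs_nonneg _), abs_of_nonneg (sq_nonneg s), abs_inv, inv_mul_eq_div] at h
  rw [discLaw_apply, discLaw_apply, mul_left_comm]
  gcongr

/-- The uniform law on the miniflag of `F`. -/
def PF.law {d k : ℕ} (hk : 1 ≤ k) (F : PF d (k - 1) (k + 1)) : Measure (Gr d k) :=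
  discLaw.map (F.line hk)

instance {d k : ℕ} (hk : 1 ≤ k) (F : PF d (k - 1) (k + 1)) : IsProbabilityMeasure (F.law hk) :=
  Measure.isProbabilityMeasure_map (measurable_line hk F).aemeasurable

/-- The uniform law on the miniflag of `F`, as a measure on the miniflag. -/
def PF.fiberLaw {d k : ℕ} (hk : 1 ≤ k) (F : PF d (k - 1) (k + 1)) : Measure (fiber F) :=
  discLaw.map fun x => ⟨F.line hk x, F.line_mem_fiber hk x⟩

theorem measurable_line_fiber {d k : ℕ} (hk : 1 ≤ k) (F : PF d (k - 1) (k + 1)) :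
    Measurable fun x => (⟨F.line hk x, F.line_mem_fiber hk x⟩ : fiber F) :=
  (measurable_line hk F).subtype_mk

instance {d k : ℕ} (hk : 1 ≤ k) (F : PF d (k - 1) (k + 1)) :
    IsProbabilityMeasure (F.fiberLaw hk) :=
  Measure.isProbabilityMeasure_map (measurable_line_fiber hk F).aemeasurable

theorem measurable_act_Gr {d k : ℕ} :
    Measurable fun p : GL (Fin d) ℝ × Gr d k => Gr.act p.1 p.2 :=
  Gr.continuous_act.measurable

theorem measurable_fiberMap_prod {d k : ℕ} (F : PF d (k - 1) (k + 1)) :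
    Measurable fun p : GL (Fin d) ℝ × fiber F => fiberMap F p.1 p.2 := by
  have h : Measurable fun p : GL (Fin d) ℝ × fiber F => (p.1, (p.2 : Gr d k)) :=
    measurable_fst.prodMk (measurable_subtype_coe.comp measurable_snd)
  have h' := measurable_act_Gr.comp h
  exact h'

theorem measurable_fiberMap {d k : ℕ} (F : PF d (k - 1) (k + 1)) (A : GL (Fin d) ℝ) :
    Measurable (fiberMap F A) := by
  have h : Measurable fun V : fiber F => (A, (V : Gr d k)) :=
    measurable_const.prodMk measurable_subtype_coe
  have h' := measurable_act_Gr.comp h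
  exact h'

/-- In `discLaw_preimage_le` take s = s_1 and |det| = s_1 s_2, so that s²/|det| = s_1/s_2. -/
theorem map_fiberLaw_le {d k : ℕ} (hk : 1 ≤ k) (F : PF d (k - 1) (k + 1)) (A : GL (Fin d) ℝ) :
    (F.fiberLaw hk).map (fiberMap F A) ≤
      ENNReal.ofReal (sv (perpMap A F) 1 / sv (perpMap A F) 2) • (PF.act A F).law hk := by
  obtain ⟨h1, h2⟩ := sv_perpMap_pos hk A F
  have hdet := abs_det_planeMap hk A F
  have hdet0 : LinearMap.det (planeMap hk A F) ≠ 0 := by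
    rw [← abs_pos, hdet]; exact mul_pos h1 h2
  refine Measure.le_iff.mpr fun S hS => ?_
  rw [Measure.map_apply (measurable_fiberMap F A) hS, PF.fiberLaw,
    Measure.map_apply (measurable_line_fiber hk F) (measurable_fiberMap F A hS), Measure.smul_apply,
    PF.law, Measure.map_apply (measurable_line hk _) hS, smul_eq_mul]
  set Z : Set (EuclideanSpace ℝ (Fin 2)) := (PF.act A F).line hk ⁻¹' S with hZ
  have hnull : ∀ᵐ x ∂discLaw, x ≠ 0 := by
    rw [ae_iff]; simpa using discLaw_singleton_zero
  -- The origin is a null set; it is dropped because `act_line` and `line_smul` are available only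
  -- for nonzero vectors.
  have hlhs : discLaw ((fun x => (⟨F.line hk x, F.line_mem_fiber hk x⟩ : fiber F)) ⁻¹'
      (fiberMap F A ⁻¹' S)) = discLaw (planeMap hk A F ⁻¹' (Z \ {0})) := by
    refine measure_congr ?_
    filter_upwards [hnull] with x hx
    refine propext ?_
    change Gr.act A (F.line hk x) ∈ S ↔ (PF.act A F).line hk (planeMap hk A F x) ∈ S ∧ _
    rw [act_line hk A F hx]
    exact (and_iff_left (planeMap_ne_zero hk A F hx)).symm
  rw [hlhs]
  refine (discLaw_preimage_le h1 hdet0 (norm_planeMap_le hk A F) ?_).trans ?_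
  · rintro y ⟨hy, hy0⟩
    refine ⟨?_, smul_ne_zero (inv_ne_zero h1.ne') hy0⟩
    rw [hZ, Set.mem_preimage, line_smul hk _ (inv_ne_zero h1.ne') hy0]
    exact hy
  · rw [hdet, sq, mul_div_mul_left _ _ h1.ne']
    gcongr
    exact Set.sdiff_subset

/-! ### Entropy bounds on one miniflag, then averaged over flags -/

/-- The uniform law on the miniflag of F₁ is the test measure. Since almost all images live on the
miniflag of F₂, its uniform law is a common reference for them. -/
theorem pushforwardEntropy_le {d k : ℕ} (hk : 1 ≤ k) (hkd : k < d) (F₁ F₂ : PF d (k - 1) (k + 1))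
    (η : Measure (GL (Fin d) ℝ)) [IsProbabilityMeasure η] (h : ∀ᵐ A ∂η, PF.act A F₁ = F₂) :
    pushforwardEntropy (fiberMap F₁) η ≤
      ∫⁻ A, ENNReal.ofReal (Real.log (sv (perpMap A F₁) 1 / sv (perpMap A F₁) 2)) ∂η := by
  let κ : Kernel (GL (Fin d) ℝ) (Gr d k) :=
    ⟨fun A => (F₁.fiberLaw hk).map (fiberMap F₁ A), by
      refine Measure.measurable_of_measurable_coe _ fun S hS => ?_
      simp_rw [fun A => Measure.map_apply (μ := F₁.fiberLaw hk) (measurable_fiberMap F₁ A) hS]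
      have hS' := measurable_fiberMap_prod F₁ hS
      exact measurable_measure_prodMk_left hS'⟩
  have hκ : IsMarkovKernel κ :=
    ⟨fun A => Measure.isProbabilityMeasure_map (measurable_fiberMap F₁ A).aemeasurable⟩
  have hc : Measurable fun A => sv (perpMap A F₁) 1 / sv (perpMap A F₁) 2 := by
    have h' := (measurable_sv_div_perpMap hk hkd).comp (measurable_prodMk_right (y := F₁))
    exact h'
  have hle : ∀ᵐ A ∂η, κ A ≤
      ENNReal.ofReal (sv (perpMap A F₁) 1 / sv (perpMap A F₁) 2) • F₂.law hk := by
    filter_upwards [h] with A hA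
    have h' := map_fiberLaw_le hk F₁ A
    rw [hA] at h'
    exact h'
  have hmain := lintegral_klDiv_bind_le κ hc hle
  have hinf : pushforwardEntropy (fiberMap F₁) η ≤
      furstenbergEntropy (fiberMap F₁) η (F₁.fiberLaw hk) :=
    iInf_le (fun ν : ProbabilityMeasure (fiber F₁) =>
        furstenbergEntropy (fiberMap F₁) η (ν : Measure (fiber F₁)))
      ⟨F₁.fiberLaw hk, inferInstance⟩
  exact hinf.trans hmain

/-- The conditional law at F₂ is carried by the matrices with AF = F₂, so the bound on a single
target applies; integrating over F₂ reassembles μ. -/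
theorem hFA_le {d k : ℕ} (hk : 1 ≤ k) (hkd : k < d) (F : PF d (k - 1) (k + 1))
    (μ : Measure (GL (Fin d) ℝ)) [IsProbabilityMeasure μ] :
    hFA F μ ≤ ∫⁻ A, ENNReal.ofReal (Real.log (sv (perpMap A F) 1 / sv (perpMap A F) 2)) ∂μ := by
  set q : GL (Fin d) ℝ → PF d (k - 1) (k + 1) := fun A => PF.act A F with hq_def
  have hq : Measurable q := measurable_act_right F
  have : IsProbabilityMeasure (μ.map q) := Measure.isProbabilityMeasure_map hq.aemeasurable
  set κ := condDistrib id q μ with hκ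
  have hdis : (μ.map q) ⊗ₘ κ = μ.map fun A => (q A, A) := compProd_map_condDistrib aemeasurable_id
  have hqm : Measurable fun A => (q A, A) := hq.prodMk measurable_id
  set g : GL (Fin d) ℝ → ℝ≥0∞ := fun A =>
    ENNReal.ofReal (Real.log (sv (perpMap A F) 1 / sv (perpMap A F) 2)) with hg_def
  have hg : Measurable g := (Real.measurable_log.comp
    ((measurable_sv_div_perpMap hk hkd).comp measurable_prodMk_right)).ennreal_ofReal
  have hae : ∀ᵐ F₂ ∂(μ.map q), ∀ᵐ A ∂(κ F₂), q A = F₂ := by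
    refine Measure.ae_ae_of_ae_compProd (p := fun z => q z.2 = z.1) ?_
    have hs : MeasurableSet {z : PF d (k - 1) (k + 1) × GL (Fin d) ℝ | q z.2 = z.1} :=
      measurableSet_eq_fun (hq.comp measurable_snd) measurable_fst
    rw [hdis, ae_map_iff hqm.aemeasurable hs]
    exact Filter.Eventually.of_forall fun _ => rfl
  calc hFA F μ ≤ ∫⁻ F₂, ∫⁻ A, g A ∂(κ F₂) ∂(μ.map q) := by
        refine lintegral_mono_ae ?_
        filter_upwards [hae] with F₂ hF₂
        exact pushforwardEntropy_le hk hkd F F₂ (κ F₂) hF₂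
    _ = ∫⁻ z, g z.2 ∂((μ.map q) ⊗ₘ κ) :=
        (Measure.lintegral_compProd (hg.comp measurable_snd)).symm
    _ = ∫⁻ A, g A ∂μ := by
        rw [hdis]
        exact lintegral_map (hg.comp measurable_snd) hqm

instance {d i j : ℕ} (hij : i ≤ j) (hjd : j ≤ d) : IsProbabilityMeasure (haarPF hij hjd) := by
  have : IsProbabilityMeasure (Measure.haarMeasure
      (⊤ : TopologicalSpace.PositiveCompacts (Matrix.orthogonalGroup (Fin d) ℝ))) :=
    ⟨Measure.haarMeasure_self⟩
  exact Measure.isProbabilityMeasure_map (measurable_orbit _).aemeasurable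

theorem lintegral_hFA_le {d : ℕ} {C : ℝ} (hC : IsGapConstant d C) {k : ℕ} (hk : 1 ≤ k)
    (hkd : k < d) (μ : Measure (GL (Fin d) ℝ)) [IsProbabilityMeasure μ]
    (hpos : ∀ A : GL (Fin d) ℝ, 0 < sv (lin A) k ∧ 0 < sv (lin A) (k + 1)) :
    ∫⁻ F : PF d (k - 1) (k + 1), hFA F μ ∂(haarPF (pred_le_succ k) hkd) ≤
      ∫⁻ A, ENNReal.ofReal (Real.log (sv (lin A) k) - Real.log (sv (lin A) (k + 1))) ∂μ +
        ENNReal.ofReal C := by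
  set m := haarPF (pred_le_succ k) hkd with hm
  set g : GL (Fin d) ℝ × PF d (k - 1) (k + 1) → ℝ≥0∞ := fun p =>
    ENNReal.ofReal (Real.log (sv (perpMap p.1 p.2) 1 / sv (perpMap p.1 p.2) 2)) with hg_def
  have hg : Measurable g :=
    (Real.measurable_log.comp (measurable_sv_div_perpMap hk hkd)).ennreal_ofReal
  calc ∫⁻ F, hFA F μ ∂m ≤ ∫⁻ F, ∫⁻ A, g (A, F) ∂μ ∂m :=
        lintegral_mono fun F => hFA_le hk hkd F μ
    _ = ∫⁻ A, ∫⁻ F, g (A, F) ∂m ∂μ :=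
        lintegral_lintegral_swap (hg.comp measurable_swap).aemeasurable
    _ ≤ ∫⁻ A, (ENNReal.ofReal (Real.log (sv (lin A) k) - Real.log (sv (lin A) (k + 1))) +
          ENNReal.ofReal C) ∂μ := by
        refine lintegral_mono fun A => ?_
        obtain ⟨hint, hle⟩ := hC k hk hkd A
        -- Since s_1 ≥ s_2 the integrand is non-negative, so its lower integral is the Bochner
        -- integral controlled by the gap constant.
        rw [← ofReal_integral_eq_lintegral_ofReal hint]
        · refine (ENNReal.ofReal_le_ofReal ?_).trans ENNReal.ofReal_add_le
          rw [Real.log_div (hpos A).1.ne' (hpos A).2.ne'] at hle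
          linarith [(abs_le.mp hle).2]
        · refine Filter.Eventually.of_forall fun F => Real.log_nonneg ?_
          rw [one_le_div (sv_perpMap_pos hk A F).2]
          exact sv_antitone _ one_le_two
    _ = _ := by
        rw [lintegral_add_right _ measurable_const, lintegral_const, measure_univ, mul_one]

theorem sv_lin_pos {d : ℕ} (A : GL (Fin d) ℝ) {k : ℕ} (hk : 1 ≤ k) (hkd : k ≤ d) :
    0 < sv (lin A) k :=
  (LinearMap.injective_iff_forall_lt_finrank_singularValues_pos (lin A)).mp (lin_injective A) _
    (by rw [finrank_euclideanSpace_fin]; omega)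

/-! ### Gram determinants -/

section Gram

variable {E : Type*} [NormedAddCommGroup E] [InnerProductSpace ℝ E]

theorem gram_sum_smul {ι κ : Type*} [Fintype ι] (u : ι → E) (X : Matrix ι κ ℝ) :
    Matrix.gram ℝ (fun j => ∑ i, X i j • u i) = X.transpose * Matrix.gram ℝ u * X := by
  ext a b
  simp only [Matrix.gram_apply, Matrix.mul_apply, Matrix.transpose_apply, sum_inner, inner_sum,
    inner_smul_left, inner_smul_right, conj_trivial, Finset.sum_mul]
  refine Finset.sum_congr rfl fun i _ => ?_
  rw [Finset.mul_sum]
  refine Finset.sum_congr rfl fun j _ => ?_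
  ring

/-- Base times height: subtracting from each w its projection to the span of v is a unitriangular
change of vectors, after which the Gram matrix is block diagonal. -/
theorem det_gram_sumElim {ι κ : Type*} [Fintype ι] [Fintype κ] [DecidableEq ι] [DecidableEq κ]
    (v : ι → E) (w : κ → E) [(Submodule.span ℝ (Set.range v)).HasOrthogonalProjection] :
    (Matrix.gram ℝ (Sum.elim v w)).det = (Matrix.gram ℝ v).det *
      (Matrix.gram ℝ fun j => w j - (Submodule.span ℝ (Set.range v)).starProjection (w j)).det := by
  set P := (Submodule.span ℝ (Set.range v)).starProjection with hP
  have hex (j : κ) : ∃ c : ι → ℝ, ∑ i, c i • v i = P (w j) :=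
    (Submodule.mem_span_range_iff_exists_fun ℝ).mp (Submodule.starProjection_apply_mem _ _)
  choose c hc using hex
  set u : ι ⊕ κ → E := Sum.elim v fun j => w j - P (w j) with hu
  set X : Matrix (ι ⊕ κ) (ι ⊕ κ) ℝ :=
    Matrix.fromBlocks 1 (Matrix.of fun i j => c j i) 0 1 with hX
  have hXu : Sum.elim v w = fun j => ∑ i, X i j • u i := by
    funext j
    rcases j with j | j
    · simp [hX, hu, Matrix.one_apply]
    · simp [hX, hu, Matrix.one_apply, hc]
  have hgu : Matrix.gram ℝ u =
      Matrix.fromBlocks (Matrix.gram ℝ v) 0 0 (Matrix.gram ℝ fun j => w j - P (w j)) := by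
    have horth (i j) : inner ℝ (w j - P (w j)) (v i) = 0 :=
      Submodule.starProjection_inner_eq_zero _ _ (Submodule.subset_span ⟨i, rfl⟩)
    ext (i | i) (j | j)
    · simp [hu]
    · simp only [hu, Matrix.gram_apply, Sum.elim_inl, Sum.elim_inr, Matrix.fromBlocks_apply₁₂,
        Matrix.zero_apply]
      rw [real_inner_comm]; exact horth i j
    · simp only [hu, Matrix.gram_apply, Sum.elim_inl, Sum.elim_inr, Matrix.fromBlocks_apply₂₁,
        Matrix.zero_apply]
      exact horth j i
    · simp [hu]
  rw [hXu, gram_sum_smul, Matrix.det_mul, Matrix.det_mul, Matrix.det_transpose, hgu,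
    Matrix.det_fromBlocks_zero₂₁, Matrix.det_fromBlocks_zero₂₁]
  simp

end Gram

/-- The Cauchy–Binet formula, with a sum over all maps instead of all subsets. -/
theorem factorial_mul_det_transpose_mul_diagonal_mul {ι n : Type*} [Fintype ι] [DecidableEq ι]
    [Fintype n] [DecidableEq n] (N : Matrix n ι ℝ) (D : n → ℝ) :
    ((Fintype.card ι).factorial : ℝ) * (N.transpose * Matrix.diagonal D * N).det =
      ∑ f : ι → n, (∏ a, D (f a)) * (N.submatrix f id).det ^ 2 := by
  have h1 : (N.transpose * Matrix.diagonal D * N).det =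
      ∑ f : ι → n, (∏ a, D (f a)) * (∏ a, N (f a) a) * (N.submatrix f id).det := by
    have hM (σ : Equiv.Perm ι) : ∏ a, (N.transpose * Matrix.diagonal D * N) (σ a) a =
        ∑ f : ι → n, ∏ a, (D (f a) * N (f a) a * N (f a) (σ a)) := by
      rw [← Fintype.prod_sum fun a x => D x * N x a * N x (σ a)]
      refine Finset.prod_congr rfl fun a _ => ?_
      rw [Matrix.mul_apply]
      refine Finset.sum_congr rfl fun x _ => ?_
      rw [Matrix.mul_diagonal, Matrix.transpose_apply]
      ring
    rw [Matrix.det_apply']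
    simp_rw [hM, Finset.mul_sum]
    rw [Finset.sum_comm]
    refine Finset.sum_congr rfl fun f _ => ?_
    rw [← Matrix.det_transpose (N.submatrix f id), Matrix.det_apply', Finset.mul_sum]
    refine Finset.sum_congr rfl fun σ _ => ?_
    simp only [Finset.prod_mul_distrib, Matrix.transpose_apply, Matrix.submatrix_apply, id]
    ring
  -- Replacing f by f ∘ τ changes its minor only by the sign of τ. Summing over τ builds the second
  -- minor, at the price of the factorial.
  have h2 (τ : Equiv.Perm ι) : (N.transpose * Matrix.diagonal D * N).det =
      ∑ f : ι → n, (∏ a, D (f a)) * (N.submatrix f id).det *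
        ((Equiv.Perm.sign τ : ℤ) * ∏ a, N (f (τ a)) a) := by
    rw [h1, ← (Equiv.arrowCongr τ (Equiv.refl n)).symm.sum_comp]
    refine Finset.sum_congr rfl fun f _ => ?_
    have hf : (Equiv.arrowCongr τ (Equiv.refl n)).symm f = f ∘ τ := rfl
    have hdet : (N.submatrix (f ∘ τ) id).det =
        (Equiv.Perm.sign τ : ℤ) * (N.submatrix f id).det := by
      rw [← Matrix.det_permute τ (N.submatrix f id)]; rfl
    rw [hf, hdet]
    simp only [Function.comp_apply]
    rw [Equiv.prod_comp τ fun a => D (f a)]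
    ring
  have h3 : ((Fintype.card ι).factorial : ℝ) * (N.transpose * Matrix.diagonal D * N).det =
      ∑ _τ : Equiv.Perm ι, (N.transpose * Matrix.diagonal D * N).det := by
    rw [Finset.sum_const, Finset.card_univ, Fintype.card_perm, nsmul_eq_mul]
  rw [h3, Finset.sum_congr rfl fun τ _ => h2 τ, Finset.sum_comm]
  refine Finset.sum_congr rfl fun f _ => ?_
  rw [← Finset.mul_sum, sq, ← mul_assoc]
  congr 1
  rw [Matrix.det_apply']
  rfl

/-- Induction on the largest element, which is at least the number of the remaining ones. -/
theorem prod_le_prod_range_of_antitone {g : ℕ → ℝ} (hg : Antitone g) (h0 : ∀ i, 0 ≤ g i)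
    (S : Finset ℕ) : ∏ i ∈ S, g i ≤ ∏ i ∈ Finset.range S.card, g i := by
  induction S using Finset.induction_on_max with
  | empty => simp
  | insert a s hs ih =>
    have ha : a ∉ s := fun h => lt_irrefl a (hs a h)
    rw [Finset.prod_insert ha, Finset.card_insert_of_notMem ha, Finset.prod_range_succ, mul_comm]
    refine mul_le_mul ih (hg ?_) (h0 a) (Finset.prod_nonneg fun i _ => h0 i)
    have : s ⊆ Finset.range a := fun x hx => Finset.mem_range.mpr (hs x hx)
    simpa using Finset.card_le_card this

/-! ### Volumes of images of frames in terms of singular values -/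

section Volume

variable {d : ℕ} (T : EuclideanSpace ℝ (Fin d) →ₗ[ℝ] EuclideanSpace ℝ (Fin d))
  {ι : Type*} [Fintype ι] [DecidableEq ι]

/-- The coordinates of a family of vectors in the basis of right singular vectors. -/
def svCoord (u : ι → EuclideanSpace ℝ (Fin d)) : Matrix (Fin d) ι ℝ :=
  Matrix.of fun i a => inner ℝ (svBasis T i) (u a)

theorem factorial_mul_det_gram (u : ι → EuclideanSpace ℝ (Fin d)) :
    ((Fintype.card ι).factorial : ℝ) * (Matrix.gram ℝ fun a => T (u a)).det =
      ∑ f : ι → Fin d, (∏ a, sv T (f a + 1) ^ 2) * ((svCoord T u).submatrix f id).det ^ 2 := by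
  rw [← factorial_mul_det_transpose_mul_diagonal_mul (svCoord T u)
    (fun i : Fin d => sv T (i + 1) ^ 2)]
  congr 2
  ext a b
  rw [Matrix.gram_apply, inner_map_map, Matrix.mul_apply]
  refine Finset.sum_congr rfl fun i _ => ?_
  rw [Matrix.mul_diagonal, Matrix.transpose_apply, svCoord, Matrix.of_apply, Matrix.of_apply,
    real_inner_comm (u a)]
  ring

theorem sum_det_svCoord_sq {u : ι → EuclideanSpace ℝ (Fin d)} (hu : Orthonormal ℝ u) :
    ∑ f : ι → Fin d, ((svCoord T u).submatrix f id).det ^ 2 = (Fintype.card ι).factorial := by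
  have h := factorial_mul_det_transpose_mul_diagonal_mul (svCoord T u) (fun _ => 1)
  simp only [Finset.prod_const_one, one_mul] at h
  rw [← h]
  have h1 : (svCoord T u).transpose * Matrix.diagonal (fun _ : Fin d => (1 : ℝ)) * svCoord T u = 1 := by
    rw [← Matrix.gram_eq_one_iff_orthonormal.mpr hu]
    ext a b
    rw [Matrix.gram_apply, ← (svBasis T).sum_inner_mul_inner, Matrix.mul_apply]
    refine Finset.sum_congr rfl fun i _ => ?_
    rw [Matrix.mul_diagonal, Matrix.transpose_apply, svCoord, Matrix.of_apply, Matrix.of_apply,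
      mul_one, real_inner_comm (u a)]
  rw [h1, Matrix.det_one, mul_one]

/-- By Cauchy–Binet the squared volume is a weighted mean of products of squared singular values,
with squared minors divided by m! as weights. Repeated indices have weight zero, and any other
product is at most the leading one. -/
theorem det_gram_map_le {u : ι → EuclideanSpace ℝ (Fin d)} (hu : Orthonormal ℝ u) :
    (Matrix.gram ℝ fun a => T (u a)).det ≤
      ∏ i ∈ Finset.range (Fintype.card ι), sv T (i + 1) ^ 2 := by
  have hpos : (0 : ℝ) < (Fintype.card ι).factorial := by positivity
  refine le_of_mul_le_mul_left ?_ hpos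
  rw [factorial_mul_det_gram, ← sum_det_svCoord_sq T hu, Finset.sum_mul]
  refine Finset.sum_le_sum fun f _ => ?_
  rw [mul_comm]
  by_cases hf : Function.Injective f
  · refine mul_le_mul_of_nonneg_left ?_ (sq_nonneg _)
    have hS := prod_le_prod_range_of_antitone (g := fun i => sv T (i + 1) ^ 2)
      (fun i j hij => pow_le_pow_left₀ (sv_nonneg T _) (sv_antitone T (by omega)) 2)
      (fun i => sq_nonneg _) (Finset.univ.image fun a => (f a : ℕ))
    rw [Finset.prod_image (fun a _ b _ h => hf (Fin.ext h)), Finset.card_image_of_injective _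
      (fun a b h => hf (Fin.ext h)), Finset.card_univ] at hS
    exact hS
  · have h0 : ((svCoord T u).submatrix f id).det = 0 := by
      obtain ⟨a, b, hab, hne⟩ : ∃ a b, f a = f b ∧ a ≠ b := by
        simpa [Function.Injective] using hf
      refine Matrix.det_zero_of_row_eq hne ?_
      ext c
      simp [hab]
    rw [h0]; simp

/-- Keeping one term of a non-negative sum gives the lower bound on volumes; this is why logarithms
of minors must be integrable. -/
theorem le_factorial_mul_det_gram_map (u : ι → EuclideanSpace ℝ (Fin d)) (f : ι → Fin d) :
    (∏ a, sv T (f a + 1) ^ 2) * ((svCoord T u).submatrix f id).det ^ 2 ≤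
      ((Fintype.card ι).factorial : ℝ) * (Matrix.gram ℝ fun a => T (u a)).det := by
  rw [factorial_mul_det_gram]
  exact Finset.single_le_sum (f := fun f : ι → Fin d =>
    (∏ a, sv T (f a + 1) ^ 2) * ((svCoord T u).submatrix f id).det ^ 2)
    (fun f _ => mul_nonneg (Finset.prod_nonneg fun a _ => sq_nonneg _) (sq_nonneg _))
    (Finset.mem_univ f)

end Volume

/-! ### Logarithmic integrability of minors of orthogonal matrices -/

/-- The function `|x|^{-1/2}`, with value `∞` at `0`. -/
def invSqrt (x : ℝ) : ℝ≥0∞ := ‖x‖ₑ ^ (-(1 / 2) : ℝ)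

theorem measurable_invSqrt : Measurable invSqrt := by
  unfold invSqrt; fun_prop

theorem invSqrt_zero : invSqrt 0 = ∞ := by
  rw [invSqrt, enorm_zero, ENNReal.zero_rpow_of_neg (by norm_num)]

theorem invSqrt_ne_top {x : ℝ} (hx : x ≠ 0) : invSqrt x ≠ ∞ :=
  ENNReal.rpow_ne_top_of_ne_zero (by simpa using hx) (by simp) 

theorem invSqrt_mul (x y : ℝ) : invSqrt (x * y) = invSqrt x * invSqrt y := by
  rw [invSqrt, enorm_mul, ENNReal.mul_rpow_of_ne_top (by simp) (by simp)]; rfl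

theorem invSqrt_anti {x y : ℝ} (h : |x| ≤ |y|) : invSqrt y ≤ invSqrt x := by
  rw [invSqrt, invSqrt, ENNReal.rpow_neg, ENNReal.rpow_neg, ENNReal.inv_le_inv]
  refine ENNReal.rpow_le_rpow ?_ (by norm_num)
  rw [← ofReal_norm, ← ofReal_norm]
  exact ENNReal.ofReal_le_ofReal h

theorem invSqrt_of_pos {x : ℝ} (hx : 0 < x) :
    invSqrt x = ENNReal.ofReal (x ^ (-(1 / 2) : ℝ)) := by
  rw [invSqrt, ← ofReal_norm, Real.norm_of_nonneg hx.le, ENNReal.ofReal_rpow_of_pos hx]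

theorem invSqrt_neg (x : ℝ) : invSqrt (-x) = invSqrt x := by
  rw [invSqrt, enorm_neg]; rfl

theorem one_le_invSqrt {x : ℝ} (hx : |x| ≤ 1) : 1 ≤ invSqrt x := by
  refine le_trans (le_of_eq ?_) (invSqrt_anti (y := 1) (by simpa using hx))
  simp [invSqrt]

theorem setLIntegral_invSqrt_ne_top : ∫⁻ t in Set.Icc (-3 : ℝ) 3, invSqrt t ≠ ∞ := by
  have h1 : ∫⁻ t in Set.Ioc (0 : ℝ) 3, invSqrt t ≠ ∞ := by
    have h := (intervalIntegral.intervalIntegrable_rpow' (a := 0) (b := 3)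
      (r := (-(1 / 2) : ℝ)) (by norm_num))
    rw [intervalIntegrable_iff_integrableOn_Ioc_of_le (by norm_num)] at h
    have h2 := Integrable.lintegral_lt_top h
    rw [setLIntegral_congr_fun (g := fun t => ENNReal.ofReal (t ^ (-(1 / 2) : ℝ)))
      measurableSet_Ioc fun t ht => invSqrt_of_pos ht.1]
    exact h2.ne
  set g : ℝ → ℝ≥0∞ := (Set.Ioc (0 : ℝ) 3).indicator invSqrt with hg
  have hgi : ∫⁻ t, g t ≠ ∞ := by rwa [hg, lintegral_indicator measurableSet_Ioc]
  have hgm : Measurable g := measurable_invSqrt.indicator measurableSet_Ioc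
  have hle : ∫⁻ t in Set.Icc (-3 : ℝ) 3, invSqrt t ≤ ∫⁻ t, (g t + g (0 - t)) := by
    rw [← lintegral_indicator measurableSet_Icc]
    refine lintegral_mono_ae ?_
    have h0 : ∀ᵐ t : ℝ, t ≠ 0 := by rw [ae_iff]; simp
    filter_upwards [h0] with t ht
    by_cases hmem : t ∈ Set.Icc (-3 : ℝ) 3
    · rw [Set.indicator_of_mem hmem]
      rcases lt_or_gt_of_ne ht with h | h
      · have : (0 - t) ∈ Set.Ioc (0 : ℝ) 3 := ⟨by linarith, by linarith [hmem.1]⟩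
        rw [hg, Set.indicator_of_mem this, zero_sub, invSqrt_neg]
        exact le_add_self
      · have : t ∈ Set.Ioc (0 : ℝ) 3 := ⟨h, hmem.2⟩
        rw [hg, Set.indicator_of_mem this]
        exact le_self_add
    · rw [Set.indicator_of_notMem hmem]
      exact zero_le
  rw [lintegral_add_left hgm, lintegral_sub_left_eq_self g 0] at hle
  exact ne_top_of_le_ne_top (ENNReal.add_ne_top.mpr ⟨hgi, hgi⟩) hle

/-- A constant for the averages of `invSqrt` over segments. -/
def segConst : ℝ≥0∞ := (2 + ∫⁻ t in Set.Icc (-3 : ℝ) 3, invSqrt t) * invSqrt (1 / 2)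

theorem segConst_ne_top : segConst ≠ ∞ :=
  ENNReal.mul_ne_top (ENNReal.add_ne_top.mpr ⟨by simp, setLIntegral_invSqrt_ne_top⟩)
    (invSqrt_ne_top (by norm_num))

theorem two_le_segConst : 2 ≤ segConst := by
  have h : 1 ≤ invSqrt (1 / 2) := one_le_invSqrt (by rw [abs_of_pos] <;> norm_num)
  calc (2 : ℝ≥0∞) ≤ (2 + ∫⁻ t in Set.Icc (-3 : ℝ) 3, invSqrt t) * 1 := by
        rw [mul_one]; exact le_self_add
    _ ≤ segConst := by unfold segConst; gcongr

theorem volume_Icc_neg_one_one : volume (Set.Icc (-1 : ℝ) 1) = 2 := by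
  rw [Real.volume_Icc]; norm_num

/-- If |x| ≥ 2|y|, then |x + ty| ≥ |x|/2. Otherwise y dominates up to a factor 2, and after dividing
by y the shift by x/y moves [-1, 1] to within [-3, 3], where the singularity is integrable. -/
theorem setLIntegral_invSqrt_add_mul_le (x y : ℝ) :
    ∫⁻ t in Set.Icc (-1 : ℝ) 1, invSqrt (x + t * y) ≤ segConst * min (invSqrt x) (invSqrt y) := by
  have hhalf : 1 ≤ invSqrt (1 / 2) := one_le_invSqrt (by rw [abs_of_pos] <;> norm_num)
  rcases le_or_gt (2 * |y|) |x| with h | h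
  · have hmin : invSqrt (1 / 2 * x) ≤ invSqrt (1 / 2) * min (invSqrt x) (invSqrt y) := by
      rw [invSqrt_mul]
      gcongr
      refine le_min le_rfl (invSqrt_anti ?_)
      linarith [abs_nonneg y]
    calc ∫⁻ t in Set.Icc (-1 : ℝ) 1, invSqrt (x + t * y)
        ≤ ∫⁻ t in Set.Icc (-1 : ℝ) 1, invSqrt (1 / 2 * x) := by
          refine setLIntegral_mono' measurableSet_Icc fun t ht => invSqrt_anti ?_
          have h1 : |t * y| ≤ |y| := by
            rw [abs_mul]
            exact mul_le_of_le_one_left (abs_nonneg y) (abs_le.mpr ht)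
          have h2 : |x| - |t * y| ≤ |x + t * y| := by
            have := abs_sub_abs_le_abs_sub x (-(t * y))
            rwa [abs_neg, sub_neg_eq_add] at this
          rw [abs_mul, abs_of_pos (by norm_num : (0 : ℝ) < 1 / 2)]
          linarith
      _ = 2 * invSqrt (1 / 2 * x) := by
          rw [lintegral_const, Measure.restrict_apply_univ, volume_Icc_neg_one_one, mul_comm]
      _ ≤ 2 * (invSqrt (1 / 2) * min (invSqrt x) (invSqrt y)) := by gcongr
      _ ≤ segConst * min (invSqrt x) (invSqrt y) := by
          rw [segConst, ← mul_assoc]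
          gcongr
          exact le_self_add
  · have hy : y ≠ 0 := by
      rintro rfl
      rw [abs_zero, mul_zero] at h
      exact absurd h (not_lt.mpr (abs_nonneg x))
    have hmin : invSqrt y ≤ invSqrt (1 / 2) * min (invSqrt x) (invSqrt y) := by
      rw [mul_min]
      · refine le_min ?_ (le_mul_of_one_le_left zero_le hhalf)
        rw [← invSqrt_mul]
        refine invSqrt_anti ?_
        rw [abs_mul, abs_of_pos (by norm_num : (0 : ℝ) < 1 / 2)]
        linarith
    calc ∫⁻ t in Set.Icc (-1 : ℝ) 1, invSqrt (x + t * y)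
        = ∫⁻ t in Set.Icc (-1 : ℝ) 1, invSqrt y * invSqrt (t + x / y) := by
          refine lintegral_congr fun t => ?_
          rw [← invSqrt_mul, mul_add, mul_div_cancel₀ _ hy, add_comm, mul_comm]
      _ = invSqrt y * ∫⁻ t in Set.Icc (-1 : ℝ) 1, invSqrt (t + x / y) :=
          lintegral_const_mul _ (measurable_invSqrt.comp (measurable_id.add_const _))
      _ ≤ invSqrt y * ∫⁻ t in Set.Icc (-3 : ℝ) 3, invSqrt t := by
          refine mul_le_mul' le_rfl ?_
          rw [← lintegral_indicator measurableSet_Icc, ← lintegral_indicator measurableSet_Icc,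
            
            ← lintegral_add_right_eq_self ((Set.Icc (-3 : ℝ) 3).indicator invSqrt) (x / y)]
          refine lintegral_mono fun t => ?_
          by_cases ht : t ∈ Set.Icc (-1 : ℝ) 1
          · have hxy : |x / y| ≤ 2 := by
              rw [abs_div, div_le_iff₀ (abs_pos.mpr hy)]; exact h.le
            rw [abs_le] at hxy
            rw [Set.indicator_of_mem ht, Set.indicator_of_mem
              (show t + x / y ∈ Set.Icc (-3 : ℝ) 3 from
                ⟨by linarith [ht.1, hxy.1], by linarith [ht.2, hxy.2]⟩)]
          · rw [Set.indicator_of_notMem ht]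
            exact zero_le
      _ ≤ invSqrt (1 / 2) * min (invSqrt x) (invSqrt y) *
            ∫⁻ t in Set.Icc (-3 : ℝ) 3, invSqrt t := by gcongr
      _ ≤ segConst * min (invSqrt x) (invSqrt y) := by
          rw [segConst, mul_right_comm, mul_comm (invSqrt (1 / 2))]
          gcongr
          exact le_add_self

/-! ### Plane rotations and their effect on minors -/

section Rotation

variable {d : ℕ}

/-- The rotation in the plane of the `a`-th and `b`-th coordinates by the angle `arctan t`. -/
def rotMatrix (a b : Fin d) (t : ℝ) : Matrix (Fin d) (Fin d) ℝ := fun i =>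
  if i = a then (√(1 + t ^ 2))⁻¹ • (Pi.single a 1 + t • Pi.single b 1)
  else if i = b then (√(1 + t ^ 2))⁻¹ • (Pi.single b 1 - t • Pi.single a 1)
  else Pi.single i 1

theorem rotMatrix_left (a b : Fin d) (t : ℝ) : rotMatrix a b t a =
    (√(1 + t ^ 2))⁻¹ • (Pi.single a 1 + t • Pi.single b 1) := if_pos rfl

theorem rotMatrix_right {a b : Fin d} (hab : a ≠ b) (t : ℝ) : rotMatrix a b t b =
    (√(1 + t ^ 2))⁻¹ • (Pi.single b 1 - t • Pi.single a 1) :=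
  (if_neg hab.symm).trans (if_pos rfl)

theorem rotMatrix_of_ne {a b i : Fin d} (ha : i ≠ a) (hb : i ≠ b) (t : ℝ) :
    rotMatrix a b t i = Pi.single i 1 :=
  (if_neg ha).trans (if_neg hb)

theorem rotMatrix_swap {a b : Fin d} (hab : a ≠ b) (t : ℝ) :
    rotMatrix a b t = rotMatrix b a (-t) := by
  funext i
  by_cases ha : i = a
  · subst ha
    rw [rotMatrix_left, rotMatrix_right hab.symm, neg_sq, neg_smul, sub_neg_eq_add]
  by_cases hb : i = b
  · subst hb
    rw [rotMatrix_left, rotMatrix_right hab, neg_sq, neg_smul, ← sub_eq_add_neg]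
  rw [rotMatrix_of_ne ha hb, rotMatrix_of_ne hb ha]

theorem inv_sqrt_sq (t : ℝ) : (√(1 + t ^ 2))⁻¹ * (√(1 + t ^ 2))⁻¹ * (1 + t ^ 2) = 1 := by
  have h : (0 : ℝ) < 1 + t ^ 2 := by positivity
  rw [← mul_inv, Real.mul_self_sqrt h.le, inv_mul_cancel₀ h.ne']

theorem rotMatrix_mem {a b : Fin d} (hab : a ≠ b) (t : ℝ) :
    rotMatrix a b t ∈ Matrix.orthogonalGroup (Fin d) ℝ := by
  rw [Matrix.mem_orthogonalGroup_iff]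
  have h := inv_sqrt_sq t
  have hl := rotMatrix_left a b t
  have hr := rotMatrix_right hab t
  set c := (√(1 + t ^ 2))⁻¹
  ext i j
  have hdot : (rotMatrix a b t * (rotMatrix a b t).transpose) i j =
      rotMatrix a b t i ⬝ᵥ rotMatrix a b t j := rfl
  rw [hdot, Matrix.one_apply]
  have key {x : Fin d} (hxa : x ≠ a) (hxb : x ≠ b) (v : Fin d → ℝ) :
      rotMatrix a b t x ⬝ᵥ v = v x := by
    rw [rotMatrix_of_ne hxa hxb, single_one_dotProduct]
  have hba := hab.symm
  by_cases hia : i = a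
  · subst hia
    by_cases hja : j = i
    · subst hja
      simp [hl, hab]
      linear_combination h
    by_cases hjb : j = b
    · subst hjb
      simp [hl, hr, hab, hba]
      exact Or.inr (by ring)
    · rw [dotProduct_comm, key hja hjb, hl, if_neg (Ne.symm hja)]
      simp [hja, hjb]
  by_cases hib : i = b
  · subst hib
    by_cases hja : j = a
    · subst hja
      simp [hl, hr, hab, hba]
      ring
    by_cases hjb : j = i
    · subst hjb
      simp [hr, hba]
      linear_combination h
    · rw [dotProduct_comm, key hja hjb, hr, if_neg (Ne.symm hjb)]
      simp [hja, hjb]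
  rw [key hia hib]
  by_cases hja : j = a
  · subst hja
    simp [hl, hia, hib]
  by_cases hjb : j = b
  · subst hjb
    simp [hr, hia, hib]
  rw [rotMatrix_of_ne hja hjb, Pi.single_apply]

/-- `rotMatrix` as an element of the orthogonal group. -/
def rot {a b : Fin d} (hab : a ≠ b) (t : ℝ) : Matrix.orthogonalGroup (Fin d) ℝ :=
  ⟨rotMatrix a b t, rotMatrix_mem hab t⟩

theorem continuous_rot {a b : Fin d} (hab : a ≠ b) : Continuous (rot hab) := by
  refine Continuous.subtype_mk (continuous_pi fun i => ?_) _
  have hc : Continuous fun t : ℝ => (√(1 + t ^ 2))⁻¹ :=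
    Continuous.inv₀ (by fun_prop) fun t => by positivity
  unfold rotMatrix
  split_ifs
  · exact hc.smul (by fun_prop)
  · exact hc.smul (by fun_prop)
  · exact continuous_const

variable {ι : Type*} [Fintype ι] [DecidableEq ι]

/-- The minor of `U` with rows `f` and columns `e`. -/
def minor (e f : ι → Fin d) (U : Matrix.orthogonalGroup (Fin d) ℝ) : ℝ :=
  ((U : Matrix (Fin d) (Fin d) ℝ).submatrix f e).det

theorem continuous_minor (e f : ι → Fin d) : Continuous (minor e f) :=
  (continuous_subtype_val.matrix_submatrix f e).matrix_det

theorem minor_of_not_injective (e : ι → Fin d) {f : ι → Fin d} (hf : ¬ Function.Injective f)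
    (U : Matrix.orthogonalGroup (Fin d) ℝ) : minor e f U = 0 := by
  obtain ⟨a, b, hab, hne⟩ : ∃ a b, f a = f b ∧ a ≠ b := by
    simpa [Function.Injective] using hf
  refine Matrix.det_zero_of_row_eq hne ?_
  ext c
  simp [hab]

theorem abs_minor_comp_perm (e f : ι → Fin d) (σ : Equiv.Perm ι)
    (U : Matrix.orthogonalGroup (Fin d) ℝ) : |minor e (f ∘ σ) U| = |minor e f U| := by
  have h : minor e (f ∘ σ) U = (Equiv.Perm.sign σ : ℤ) * minor e f U := by
    rw [minor, minor, ← Matrix.det_permute σ]; rfl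
  rw [h, abs_mul]
  rcases Int.units_eq_one_or (Equiv.Perm.sign σ) with h | h <;> simp [h]

theorem rot_mul_left {a b : Fin d} (hab : a ≠ b) (t : ℝ) (U : Matrix.orthogonalGroup (Fin d) ℝ) :
    ((rot hab t * U : Matrix.orthogonalGroup (Fin d) ℝ) : Matrix (Fin d) (Fin d) ℝ) a =
      (√(1 + t ^ 2))⁻¹ • (U.1 a + t • U.1 b) := by
  change (rotMatrix a b t * U.1) a = _
  rw [Matrix.mul_apply_eq_vecMul, rotMatrix_left, Matrix.smul_vecMul, Matrix.add_vecMul,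
    Matrix.smul_vecMul, Matrix.single_one_vecMul, Matrix.single_one_vecMul]
  rfl

theorem rot_mul_right {a b : Fin d} (hab : a ≠ b) (t : ℝ) (U : Matrix.orthogonalGroup (Fin d) ℝ) :
    ((rot hab t * U : Matrix.orthogonalGroup (Fin d) ℝ) : Matrix (Fin d) (Fin d) ℝ) b =
      (√(1 + t ^ 2))⁻¹ • (U.1 b - t • U.1 a) := by
  change (rotMatrix a b t * U.1) b = _
  rw [Matrix.mul_apply_eq_vecMul, rotMatrix_right hab, Matrix.smul_vecMul, Matrix.sub_vecMul,
    Matrix.smul_vecMul, Matrix.single_one_vecMul, Matrix.single_one_vecMul]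
  rfl

theorem rot_mul_of_ne {a b i : Fin d} (hab : a ≠ b) (ha : i ≠ a) (hb : i ≠ b) (t : ℝ)
    (U : Matrix.orthogonalGroup (Fin d) ℝ) :
    ((rot hab t * U : Matrix.orthogonalGroup (Fin d) ℝ) : Matrix (Fin d) (Fin d) ℝ) i = U.1 i := by
  change (rotMatrix a b t * U.1) i = _
  rw [Matrix.mul_apply_eq_vecMul, rotMatrix_of_ne ha hb, Matrix.single_one_vecMul]
  rfl

/-- Multilinearity in the single affected row. Using the tangent t as parameter makes the minor
affine in t up to normalization. -/
theorem minor_rot_of_notMem (e : ι → Fin d) {f : ι → Fin d} (hf : Function.Injective f) {i : ι}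
    {b : Fin d} (hab : f i ≠ b) (hb : ∀ l, f l ≠ b) (t : ℝ)
    (U : Matrix.orthogonalGroup (Fin d) ℝ) : minor e f (rot hab t * U) =
      (√(1 + t ^ 2))⁻¹ * (minor e f U + t * minor e (Function.update f i b) U) := by
  have hM : ((rot hab t * U : Matrix.orthogonalGroup (Fin d) ℝ).1).submatrix f e =
      (U.1.submatrix f e).updateRow i
        ((√(1 + t ^ 2))⁻¹ • ((U.1.submatrix f e) i + t • fun l => U.1 b (e l))) := by
    ext l m
    by_cases h : l = i
    · subst h
      rw [Matrix.updateRow_self, Matrix.submatrix_apply, rot_mul_left]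
      rfl
    · rw [Matrix.updateRow_ne h, Matrix.submatrix_apply, rot_mul_of_ne hab (hf.ne h) (hb l)]
      rfl
  have hN : U.1.submatrix (Function.update f i b) e =
      (U.1.submatrix f e).updateRow i fun l => U.1 b (e l) := by
    ext l m
    by_cases h : l = i
    · subst h; simp
    · simp [h]
  rw [minor, hM, Matrix.det_updateRow_smul, Matrix.det_updateRow_add, Matrix.det_updateRow_smul,
    Matrix.updateRow_eq_self, minor, minor, hN]

theorem minor_rot_of_mem (e : ι → Fin d) {f : ι → Fin d} (hf : Function.Injective f) {i j : ι}
    (hab : f i ≠ f j) (t : ℝ) (U : Matrix.orthogonalGroup (Fin d) ℝ) :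
    minor e f (rot hab t * U) = minor e f U := by
  have hij : i ≠ j := fun h => hab (by rw [h])
  have h := inv_sqrt_sq t
  have hc0 : (√(1 + t ^ 2))⁻¹ ≠ 0 := by positivity
  set c := (√(1 + t ^ 2))⁻¹ with hc
  set M := U.1.submatrix f e with hMdef
  set N := M.updateRow i (c • (M i + t • M j)) with hN
  -- The rotation of two rows is factored into two row operations with scalings c and c⁻¹, by c⁻¹ =
  -- c(1 + t²).
  have hM : ((rot hab t * U : Matrix.orthogonalGroup (Fin d) ℝ).1).submatrix f e =
      N.updateRow j ((c⁻¹ : ℝ) • N j + (-t) • N i) := by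
    have hNi : N i = c • (M i + t • M j) := Matrix.updateRow_self
    have hNj : N j = M j := Matrix.updateRow_ne hij.symm
    ext l m
    by_cases hl : l = j
    · subst hl
      rw [Matrix.updateRow_self, Matrix.submatrix_apply, rot_mul_right, hNi, hNj]
      change c * (M l m - t * M i m) = c⁻¹ * M l m + (-t) * (c * (M i m + t * M l m))
      have : c⁻¹ = c * (1 + t ^ 2) := by field_simp; linear_combination -h
      rw [this]; ring
    · rw [Matrix.updateRow_ne hl]
      by_cases hl' : l = i
      · subst hl'
        rw [hNi, Matrix.submatrix_apply, rot_mul_left]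
        rfl
      · rw [hN, Matrix.updateRow_ne hl', Matrix.submatrix_apply,
          rot_mul_of_ne hab (hf.ne hl') (hf.ne hl)]
        rfl
  rw [minor, hM, Matrix.det_updateRow_add, Matrix.det_updateRow_smul, Matrix.det_updateRow_smul,
    Matrix.updateRow_eq_self, Matrix.det_updateRow_eq_zero hij, mul_zero, add_zero, hN,
    Matrix.det_updateRow_smul, Matrix.det_updateRow_add, Matrix.det_updateRow_smul,
    Matrix.updateRow_eq_self, Matrix.det_updateRow_eq_zero hij.symm, mul_zero, add_zero,
    inv_mul_cancel_left₀ hc0]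
  rfl

theorem minor_rot_of_forall_ne (e : ι → Fin d) {f : ι → Fin d} {a b : Fin d} (hab : a ≠ b)
    (ha : ∀ l, f l ≠ a) (hb : ∀ l, f l ≠ b) (t : ℝ) (U : Matrix.orthogonalGroup (Fin d) ℝ) :
    minor e f (rot hab t * U) = minor e f U := by
  rw [minor, minor]
  congr 1
  ext l m
  rw [Matrix.submatrix_apply, rot_mul_of_ne hab (ha l) (hb l)]
  rfl

theorem invSqrt_inv_sqrt_le {t : ℝ} (ht : t ∈ Set.Icc (-1 : ℝ) 1) :
    invSqrt (√(1 + t ^ 2))⁻¹ ≤ invSqrt (1 / 2) := by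
  refine invSqrt_anti ?_
  rw [abs_of_pos (by norm_num), abs_of_pos (by positivity), one_div]
  refine inv_anti₀ (by positivity) ?_
  rw [Real.sqrt_le_left (by norm_num)]
  nlinarith [ht.1, ht.2]

/-- A constant for the averages over rotations. -/
def rotConst : ℝ≥0∞ := invSqrt (1 / 2) * segConst

theorem rotConst_ne_top : rotConst ≠ ∞ :=
  ENNReal.mul_ne_top (invSqrt_ne_top (by norm_num)) segConst_ne_top

theorem two_le_rotConst : 2 ≤ rotConst := by
  have h : 1 ≤ invSqrt (1 / 2) := one_le_invSqrt (by rw [abs_of_pos] <;> norm_num)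
  calc (2 : ℝ≥0∞) = 1 * 2 := (one_mul _).symm
    _ ≤ rotConst := mul_le_mul' h two_le_segConst

theorem setLIntegral_invSqrt_rot_le (x y : ℝ) :
    ∫⁻ t in Set.Icc (-1 : ℝ) 1, invSqrt ((√(1 + t ^ 2))⁻¹ * (x + t * y)) ≤
      rotConst * min (invSqrt x) (invSqrt y) := by
  calc _ ≤ ∫⁻ t in Set.Icc (-1 : ℝ) 1, invSqrt (1 / 2) * invSqrt (x + t * y) := by
        refine setLIntegral_mono' measurableSet_Icc fun t ht => ?_
        rw [invSqrt_mul]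
        exact mul_le_mul' (invSqrt_inv_sqrt_le ht) le_rfl
    _ = invSqrt (1 / 2) * ∫⁻ t in Set.Icc (-1 : ℝ) 1, invSqrt (x + t * y) :=
        lintegral_const_mul _ (measurable_invSqrt.comp (by fun_prop))
    _ ≤ _ := by
        rw [rotConst, mul_assoc]
        exact mul_le_mul' le_rfl (setLIntegral_invSqrt_add_mul_le x y)

theorem setLIntegral_minor_rot_update_le (e : ι → Fin d) {f : ι → Fin d}
    (hf : Function.Injective f) {i : ι} {b : Fin d} (hab : f i ≠ b) (hb : ∀ l, f l ≠ b)
    (U : Matrix.orthogonalGroup (Fin d) ℝ) :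
    ∫⁻ t in Set.Icc (-1 : ℝ) 1, invSqrt (minor e f (rot hab t * U)) ≤
      rotConst * min (invSqrt (minor e f U)) (invSqrt (minor e (Function.update f i b) U)) := by
  simp_rw [minor_rot_of_notMem e hf hab hb]
  exact setLIntegral_invSqrt_rot_le _ _

/-- The minor varies with t only if exactly one of the rows a, b is selected. A constant integrand
contributes the length 2 of the interval. -/
theorem setLIntegral_minor_rot_le (e : ι → Fin d) {f : ι → Fin d} (hf : Function.Injective f)
    {a b : Fin d} (hab : a ≠ b) (U : Matrix.orthogonalGroup (Fin d) ℝ) :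
    ∫⁻ t in Set.Icc (-1 : ℝ) 1, invSqrt (minor e f (rot hab t * U)) ≤
      rotConst * invSqrt (minor e f U) := by
  have hconst (h : ∀ t, minor e f (rot hab t * U) = minor e f U) :
      ∫⁻ t in Set.Icc (-1 : ℝ) 1, invSqrt (minor e f (rot hab t * U)) ≤
        rotConst * invSqrt (minor e f U) := by
    simp_rw [h]
    rw [lintegral_const, Measure.restrict_apply_univ, volume_Icc_neg_one_one, mul_comm]
    exact mul_le_mul' two_le_rotConst le_rfl
  by_cases ha : ∃ i, f i = a <;> by_cases hb : ∃ j, f j = b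
  · obtain ⟨i, rfl⟩ := ha
    obtain ⟨j, rfl⟩ := hb
    exact hconst fun t => minor_rot_of_mem e hf hab t U
  · obtain ⟨i, rfl⟩ := ha
    exact (setLIntegral_minor_rot_update_le e hf hab (not_exists.mp hb) U).trans
      (mul_le_mul' le_rfl (min_le_left _ _))
  · obtain ⟨j, rfl⟩ := hb
    -- Exchanging the two coordinates reverses the angle and reduces to the case of a selected first
    -- row.
    have hsw (t : ℝ) : rot hab t = rot hab.symm (-t) := Subtype.ext (rotMatrix_swap hab t)
    simp_rw [hsw, minor_rot_of_notMem e hf hab.symm (not_exists.mp ha), neg_sq, neg_mul,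
      ← mul_neg]
    refine (setLIntegral_invSqrt_rot_le _ _).trans (mul_le_mul' le_rfl (min_le_left _ _))
  · exact hconst fun t => minor_rot_of_forall_ne e hab (not_exists.mp ha) (not_exists.mp hb) t U

end Rotation

/-! ### Integrability of inverse square roots and logarithms of minors -/

section Orthogonal

variable {d : ℕ}

/-- The normalized Haar measure on `O(d)`. -/
abbrev haarO (d : ℕ) : Measure (Matrix.orthogonalGroup (Fin d) ℝ) :=
  Measure.haarMeasure (⊤ : TopologicalSpace.PositiveCompacts (Matrix.orthogonalGroup (Fin d) ℝ))

instance : IsProbabilityMeasure (haarO d) := ⟨Measure.haarMeasure_self⟩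

instance : SecondCountableTopology (Matrix.orthogonalGroup (Fin d) ℝ) :=
  have : SecondCountableTopology (Matrix (Fin d) (Fin d) ℝ) :=
    inferInstanceAs (SecondCountableTopology (Fin d → Fin d → ℝ))
  inferInstanceAs (SecondCountableTopology
    {x // x ∈ (Matrix.orthogonalGroup (Fin d) ℝ : Set (Matrix (Fin d) (Fin d) ℝ))})

variable {ι : Type*} [Fintype ι] [DecidableEq ι]

/-- The smallest value of `invSqrt` on the minors with rows in `S`. -/
def minorInf (e : ι → Fin d) (S : Finset (ι → Fin d)) (U : Matrix.orthogonalGroup (Fin d) ℝ) :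
    ℝ≥0∞ :=
  S.inf fun f => invSqrt (minor e f U)

theorem measurable_minorInf (e : ι → Fin d) (S : Finset (ι → Fin d)) :
    Measurable (minorInf e S) := by
  induction S using Finset.induction_on with
  | empty => exact measurable_const
  | insert f S hf ih =>
    have h : minorInf e (insert f S) = fun U => min (invSqrt (minor e f U)) (minorInf e S U) := by
      funext U
      rw [minorInf, Finset.inf_insert]
      rfl
    rw [h]
    exact (measurable_invSqrt.comp (continuous_minor e f).measurable).min ih

/-- Let g attain the minimum at U. If g is the new map, the rotated minor of f already sees the
minor of g; otherwise the rotated minor of g itself is used. -/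
theorem setLIntegral_minorInf_rot_le (e : ι → Fin d) {S : Finset (ι → Fin d)}
    (hS : ∀ g ∈ S, Function.Injective g) {f : ι → Fin d} (hf : f ∈ S) {i : ι} {b : Fin d}
    (hab : f i ≠ b) (hb : ∀ l, f l ≠ b) (U : Matrix.orthogonalGroup (Fin d) ℝ) :
    ∫⁻ t in Set.Icc (-1 : ℝ) 1, minorInf e S (rot hab t * U) ≤
      rotConst * minorInf e (insert (Function.update f i b) S) U := by
  obtain ⟨g, hg, hgU⟩ := Finset.exists_mem_eq_inf (insert (Function.update f i b) S)
    (Finset.insert_nonempty _ _) fun g => invSqrt (minor e g U)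
  rw [minorInf, hgU]
  have hle (g' : ι → Fin d) (hg' : g' ∈ S) :
      ∫⁻ t in Set.Icc (-1 : ℝ) 1, minorInf e S (rot hab t * U) ≤
        ∫⁻ t in Set.Icc (-1 : ℝ) 1, invSqrt (minor e g' (rot hab t * U)) :=
    lintegral_mono fun t => Finset.inf_le hg'
  rcases Finset.mem_insert.mp hg with rfl | hgS
  · exact ((hle f hf).trans (setLIntegral_minor_rot_update_le e (hS f hf) hab hb U)).trans
      (mul_le_mul' le_rfl (min_le_right _ _))
  · exact (hle g hgS).trans (setLIntegral_minor_rot_le e (hS g hgS) hab U)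

/-- Left invariance of Haar measure allows inserting the average over rotations. Thus adjoining one
more row choice to the minimum costs only a constant. -/
theorem lintegral_minorInf_le (e : ι → Fin d) {S : Finset (ι → Fin d)}
    (hS : ∀ g ∈ S, Function.Injective g) {f : ι → Fin d} (hf : f ∈ S) {i : ι} {b : Fin d}
    (hab : f i ≠ b) (hb : ∀ l, f l ≠ b) :
    ∫⁻ U, minorInf e S U ∂(haarO d) ≤
      rotConst * ∫⁻ U, minorInf e (insert (Function.update f i b) S) U ∂(haarO d) := by
  have hm : Measurable (Function.uncurry fun (t : ℝ) (U : Matrix.orthogonalGroup (Fin d) ℝ) =>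
      minorInf e S (rot hab t * U)) := by
    have hc : Continuous fun p : ℝ × Matrix.orthogonalGroup (Fin d) ℝ => rot hab p.1 * p.2 :=
      ((continuous_rot hab).comp continuous_fst).mul continuous_snd
    exact (measurable_minorInf e S).comp hc.measurable
  calc ∫⁻ U, minorInf e S U ∂(haarO d)
      ≤ 2 * ∫⁻ U, minorInf e S U ∂(haarO d) := le_mul_of_one_le_left zero_le one_le_two
    _ = ∫⁻ t in Set.Icc (-1 : ℝ) 1, ∫⁻ U, minorInf e S (rot hab t * U) ∂(haarO d) := by
        simp_rw [lintegral_mul_left_eq_self (μ := haarO d) (minorInf e S)]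
        rw [lintegral_const, Measure.restrict_apply_univ, volume_Icc_neg_one_one, mul_comm]
    _ = ∫⁻ U, (∫⁻ t in Set.Icc (-1 : ℝ) 1, minorInf e S (rot hab t * U)) ∂(haarO d) :=
        lintegral_lintegral_swap hm.aemeasurable
    _ ≤ ∫⁻ U, rotConst * minorInf e (insert (Function.update f i b) S) U ∂(haarO d) :=
        lintegral_mono fun U => setLIntegral_minorInf_rot_le e hS hf hab hb U
    _ = _ := lintegral_const_mul _ (measurable_minorInf e _)

theorem exists_perm_of_image_eq {ι : Type*} [Fintype ι] {f g : ι → Fin d} (hg : Function.Injective g)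
    (h : Finset.univ.image f = Finset.univ.image g) : ∃ σ : Equiv.Perm ι, f ∘ σ = g := by
  have hex (x : ι) : ∃ y, f y = g x := by
    have : g x ∈ Finset.univ.image f := h ▸ Finset.mem_image_of_mem g (Finset.mem_univ x)
    simpa using this
  choose s hs using hex
  have hinj : Function.Injective s := fun x y hxy => hg (by rw [← hs x, ← hs y, hxy])
  exact ⟨Equiv.ofBijective s (Finite.injective_iff_bijective.mp hinj), funext hs⟩

/-- A family of injective maps that is closed under changes of one value contains a map with every
possible range. -/
theorem exists_mem_image_eq {S : Finset (ι → Fin d)} (hne : S.Nonempty)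
    (hS : ∀ f ∈ S, Function.Injective f)
    (hcl : ∀ f ∈ S, ∀ (i : ι) (b : Fin d), (∀ l, f l ≠ b) → Function.update f i b ∈ S)
    {g : ι → Fin d} (hg : Function.Injective g) :
    ∃ f ∈ S, Finset.univ.image f = Finset.univ.image g := by
  -- A member whose range overlaps most with that of g: were the ranges different, exchanging one
  -- value would increase the overlap.
  obtain ⟨f, hf, hmax⟩ := Finset.exists_max_image S
    (fun f => (Finset.univ.image f ∩ Finset.univ.image g).card) hne
  refine ⟨f, hf, ?_⟩
  by_contra hfg
  have hcf : (Finset.univ.image f).card = Fintype.card ι := by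
    rw [Finset.card_image_of_injective _ (hS f hf), Finset.card_univ]
  have hcg : (Finset.univ.image g).card = Fintype.card ι := by
    rw [Finset.card_image_of_injective _ hg, Finset.card_univ]
  obtain ⟨b, hbg, hbf⟩ : ∃ b ∈ Finset.univ.image g, b ∉ Finset.univ.image f := by
    by_contra! hcon
    exact hfg (Finset.eq_of_subset_of_card_le hcon (by rw [hcf, hcg])).symm
  obtain ⟨a, haf, hag⟩ : ∃ a ∈ Finset.univ.image f, a ∉ Finset.univ.image g := by
    by_contra! hcon
    exact hfg (Finset.eq_of_subset_of_card_le hcon (by rw [hcf, hcg]))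
  obtain ⟨i, -, rfl⟩ := Finset.mem_image.mp haf
  have hb : ∀ l, f l ≠ b := fun l h => hbf (h ▸ Finset.mem_image_of_mem f (Finset.mem_univ l))
  refine absurd (hmax _ (hcl f hf i b hb)) (not_le.mpr (Finset.card_lt_card ?_))
  rw [Finset.ssubset_iff_of_subset]
  · refine ⟨b, Finset.mem_inter.mpr ⟨?_, hbg⟩, fun h => hbf (Finset.mem_inter.mp h).1⟩
    exact Finset.mem_image.mpr ⟨i, Finset.mem_univ i, Function.update_self i b f⟩
  · intro x hx
    obtain ⟨hxf, hxg⟩ := Finset.mem_inter.mp hx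
    obtain ⟨l, -, rfl⟩ := Finset.mem_image.mp hxf
    have hl : l ≠ i := fun h => hag (h ▸ hxg)
    exact Finset.mem_inter.mpr
      ⟨Finset.mem_image.mpr ⟨l, Finset.mem_univ l, Function.update_of_ne hl b f⟩, hxg⟩

theorem sum_minor_sq {e : ι → Fin d} (he : Function.Injective e)
    (U : Matrix.orthogonalGroup (Fin d) ℝ) :
    ∑ f : ι → Fin d, minor e f U ^ 2 = (Fintype.card ι).factorial := by
  have h := factorial_mul_det_transpose_mul_diagonal_mul (U.1.submatrix id e) (fun _ => 1)
  simp only [Finset.prod_const_one, one_mul, Matrix.diagonal_one, Matrix.mul_one] at h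
  have hU : U.1.transpose * U.1 = 1 := (Matrix.mem_orthogonalGroup_iff' (Fin d) ℝ).mp U.2
  have h1 : (U.1.submatrix id e).transpose * U.1.submatrix id e = 1 := by
    ext a b
    change (U.1.transpose * U.1) (e a) (e b) = _
    simp only [hU, Matrix.one_apply, he.eq_iff]
  rw [h1, Matrix.det_one, mul_one] at h
  exact h.symm

/-- Starting from {f₀}, enlarge the family at finite cost until it is maximal. It is then closed
under replacing a row and meets every row set. At each U some minor is bounded below, so the minimum
of the inverse square roots is bounded. -/
theorem lintegral_invSqrt_minor_ne_top {e f₀ : ι → Fin d} (he : Function.Injective e)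
    (hf₀ : Function.Injective f₀) : ∫⁻ U, invSqrt (minor e f₀ U) ∂(haarO d) ≠ ∞ := by
  set I : Finset (ι → Fin d) → ℝ≥0∞ := fun S => ∫⁻ U, minorInf e S U ∂(haarO d) with hI
  obtain ⟨S, ⟨hf₀S, hS, C, hC, hIS⟩, hmax⟩ := Set.Finite.exists_maximal
    (s := {S : Finset (ι → Fin d) | f₀ ∈ S ∧ (∀ f ∈ S, Function.Injective f) ∧
      ∃ C : ℝ≥0∞, C ≠ ∞ ∧ I {f₀} ≤ C * I S}) (Set.toFinite _)
    ⟨{f₀}, by simp, by simpa using hf₀, 1, by simp, by simp⟩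
  have hcl (f) (hf : f ∈ S) (i : ι) (b : Fin d) (hb : ∀ l, f l ≠ b) :
      Function.update f i b ∈ S := by
    refine hmax (y := insert (Function.update f i b) S) ⟨Finset.mem_insert_of_mem hf₀S, ?_,
      C * rotConst, ENNReal.mul_ne_top hC rotConst_ne_top, ?_⟩ (Finset.subset_insert _ _)
      (Finset.mem_insert_self _ _)
    · intro g hg
      rcases Finset.mem_insert.mp hg with rfl | hg
      · intro x y hxy
        by_cases hx : x = i <;> by_cases hy : y = i
        · rw [hx, hy]
        · subst hx
          rw [Function.update_self, Function.update_of_ne hy] at hxy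
          exact absurd hxy.symm (hb y)
        · subst hy
          rw [Function.update_self, Function.update_of_ne hx] at hxy
          exact absurd hxy (hb x)
        · rw [Function.update_of_ne hx, Function.update_of_ne hy] at hxy
          exact hS f hf hxy
      · exact hS g hg
    · rw [mul_assoc]
      exact hIS.trans (mul_le_mul' le_rfl (lintegral_minorInf_le e hS hf (hb i) hb))
  -- The squared minors over all maps sum to a factorial, hence to at least 1, so one of them
  -- reaches δ.
  set δ : ℝ := 1 / Fintype.card (ι → Fin d) with hδ
  have : Nonempty (ι → Fin d) := ⟨f₀⟩
  have hδ0 : 0 < δ := by positivity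
  have hbound (U : Matrix.orthogonalGroup (Fin d) ℝ) : minorInf e S U ≤ invSqrt √δ := by
    obtain ⟨g, -, hg⟩ : ∃ g ∈ (Finset.univ : Finset (ι → Fin d)), δ ≤ minor e g U ^ 2 := by
      refine Finset.exists_le_of_sum_le Finset.univ_nonempty ?_
      rw [sum_minor_sq he, Finset.sum_const, Finset.card_univ, nsmul_eq_mul, hδ,
        mul_one_div_cancel (by positivity)]
      exact_mod_cast Nat.one_le_iff_ne_zero.mpr (Nat.factorial_ne_zero _)
    have hg0 : minor e g U ≠ 0 := by
      intro h
      rw [h] at hg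
      simp at hg
      linarith
    have hginj : Function.Injective g := by
      by_contra hcon
      exact hg0 (minor_of_not_injective e hcon U)
    obtain ⟨f, hf, hfg⟩ := exists_mem_image_eq ⟨f₀, hf₀S⟩ hS hcl hginj
    obtain ⟨σ, rfl⟩ := exists_perm_of_image_eq hginj hfg
    refine (Finset.inf_le hf).trans (invSqrt_anti ?_)
    rw [← abs_minor_comp_perm e f σ U, abs_of_nonneg (Real.sqrt_nonneg _)]
    exact Real.sqrt_le_iff.mpr ⟨abs_nonneg _, by rwa [sq_abs]⟩
  have hle : I S ≤ invSqrt √δ := by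
    refine (lintegral_mono hbound).trans ?_
    rw [lintegral_const, measure_univ, mul_one]
  have h0 : ∫⁻ U, invSqrt (minor e f₀ U) ∂(haarO d) = I {f₀} := by
    simp only [hI, minorInf, Finset.inf_singleton]
  rw [h0]
  refine ne_top_of_le_ne_top (ENNReal.mul_ne_top hC ?_) (hIS.trans (mul_le_mul' le_rfl hle))
  exact invSqrt_ne_top (Real.sqrt_ne_zero'.mpr hδ0)

theorem ae_minor_ne_zero {e f : ι → Fin d} (he : Function.Injective e)
    (hf : Function.Injective f) : ∀ᵐ U ∂(haarO d), minor e f U ≠ 0 := by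
  filter_upwards [ae_lt_top (measurable_invSqrt.comp (continuous_minor e f).measurable)
    (lintegral_invSqrt_minor_ne_top he hf)] with U hU h
  rw [Function.comp_apply, h, invSqrt_zero] at hU
  exact lt_irrefl _ hU

theorem enorm_log_le (x : ℝ) : ‖Real.log x‖ₑ ≤ 2 * invSqrt x + ‖x‖ₑ := by
  rcases eq_or_ne x 0 with rfl | hx
  · simp
  have hx' : 0 < |x| := abs_pos.mpr hx
  have h1 : invSqrt x = ENNReal.ofReal (|x| ^ (-(1 / 2) : ℝ)) := by
    rw [← invSqrt_of_pos hx']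
    exact le_antisymm (invSqrt_anti (abs_abs x).le) (invSqrt_anti (abs_abs x).ge)
  rw [h1, ← ofReal_norm, ← ofReal_norm, Real.norm_eq_abs, Real.norm_eq_abs, ← Real.log_abs x,
    ← ENNReal.ofReal_ofNat, ← ENNReal.ofReal_mul (by norm_num),
    ← ENNReal.ofReal_add (by positivity) (by positivity)]
  refine ENNReal.ofReal_le_ofReal ?_
  have hup := Real.log_le_self hx'.le
  -- The exponent ε = 1/2 matches `invSqrt` and produces the factor 2.
  have hlo := Real.log_le_rpow_div (x := |x|⁻¹) (by positivity) (ε := 1 / 2) (by norm_num)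
  rw [Real.log_inv, Real.inv_rpow hx'.le, ← Real.rpow_neg hx'.le] at hlo
  have hp : 0 ≤ |x| ^ (-(1 / 2) : ℝ) := by positivity
  rw [abs_le]
  constructor <;> linarith

theorem integrable_log_minor {e f : ι → Fin d} (he : Function.Injective e)
    (hf : Function.Injective f) : Integrable (fun U => Real.log (minor e f U)) (haarO d) := by
  have hcm := continuous_minor e f
  refine ⟨(Real.measurable_log.comp hcm.measurable).aestronglyMeasurable, ?_⟩
  have hm : Measurable fun U => invSqrt (minor e f U) := measurable_invSqrt.comp hcm.measurable
  have hint : Integrable (minor e f) (haarO d) :=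
    hcm.integrable_of_hasCompactSupport (HasCompactSupport.of_compactSpace _)
  refine (lintegral_mono fun U => enorm_log_le (minor e f U)).trans_lt ?_
  rw [lintegral_add_right _ hcm.measurable.enorm,
    lintegral_const_mul _ hm]
  exact ENNReal.add_lt_top.mpr ⟨ENNReal.mul_lt_top (by simp)
    (lintegral_invSqrt_minor_ne_top he hf).lt_top, hint.2⟩

end Orthogonal

/-! ### Volumes relative to a flag, for a fixed matrix -/

section Deterministic

variable {d : ℕ} {ι κ : Type*} [Fintype ι] [Fintype κ] [DecidableEq ι] [DecidableEq κ]

/-- For w in the plane, `perpMap B F w` is the part of Bw orthogonal to BV_i, that is, the height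
over the base BV_i. -/
theorem det_gram_map_sumElim {i j : ℕ} (B : GL (Fin d) ℝ) (F : PF d i j)
    {u : ι → EuclideanSpace ℝ (Fin d)} (hu : Submodule.span ℝ (Set.range u) = F.lo)
    {w : κ → EuclideanSpace ℝ (Fin d)} (hw : ∀ a, w a ∈ F.diff) :
    (Matrix.gram ℝ fun a => lin B (Sum.elim u w a)).det =
      (Matrix.gram ℝ fun a => lin B (u a)).det *
        (Matrix.gram ℝ fun a => perpMap B F (w a)).det := by
  have hspan : Submodule.span ℝ (Set.range fun a => lin B (u a)) = (PF.act B F).lo := by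
    change _ = F.lo.map (lin B)
    rw [← hu, Submodule.map_span, ← Set.range_comp]
    rfl
  have h := det_gram_sumElim (fun a => lin B (u a)) fun a => lin B (w a)
  have h1 : (Sum.elim (fun a => lin B (u a)) fun a => lin B (w a)) =
      fun a => lin B (Sum.elim u w a) := by
    funext a; cases a <;> rfl
  rw [h1] at h
  rw [h]
  congr 3
  funext a
  rw [perpMap_of_mem B F (hw a), starProjection_inf_orthogonal (PF.act B F).lo_le_hi,
    FunLike.coe_sub, Pi.sub_apply, (PF.act B F).hi.starProjection_eq_self_iff.mpr
      (Submodule.mem_map_of_mem (hw a).1), hspan]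

theorem exists_planeBasis {k : ℕ} (hk : 1 ≤ k) (F : PF d (k - 1) (k + 1))
    {e : Fin 2 → EuclideanSpace ℝ (Fin d)} (he : Orthonormal ℝ e) (hmem : ∀ a, e a ∈ F.diff) :
    ∃ b : OrthonormalBasis (Fin 2) ℝ F.diff, ∀ a, (b a : EuclideanSpace ℝ (Fin d)) = e a := by
  have hon : Orthonormal ℝ fun a => (⟨e a, hmem a⟩ : F.diff) := by
    refine ⟨fun a => he.1 a, fun a b hab => he.2 hab⟩
  have hsp := hon.linearIndependent.span_eq_top_of_card_eq_finrank
    (by rw [F.finrank_diff_eq_two hk, Fintype.card_fin])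
  refine ⟨OrthonormalBasis.mk hon hsp.ge, fun a => ?_⟩
  rw [OrthonormalBasis.coe_mk]

theorem orthonormal_sumElim {ι κ : Type*} {i j : ℕ} (F : PF d i j)
    {u : ι → EuclideanSpace ℝ (Fin d)} (hu : Orthonormal ℝ u)
    (hspan : Submodule.span ℝ (Set.range u) = F.lo)
    {w : κ → EuclideanSpace ℝ (Fin d)} (hw : Orthonormal ℝ w) (hmem : ∀ a, w a ∈ F.diff) :
    Orthonormal ℝ (Sum.elim u w) := by
  have h0 (a : ι) (b : κ) : inner ℝ (u a) (w b) = 0 :=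
    Submodule.inner_right_of_mem_orthogonal (hspan ▸ Submodule.subset_span ⟨a, rfl⟩) (hmem b).2
  refine ⟨fun a => ?_, fun a b hab => ?_⟩
  · cases a with
    | inl a => exact hu.1 a
    | inr a => exact hw.1 a
  · cases a with
    | inl a =>
      cases b with
      | inl b => exact hu.2 fun h => hab (h ▸ rfl)
      | inr b => exact h0 a b
    | inr a =>
      cases b with
      | inl b => exact (real_inner_comm _ _).trans (h0 b a)
      | inr b => exact hw.2 fun h => hab (h ▸ rfl)

/-- Adjoin to the frame of V_{k-1} a unit vector of the plane stretched by at least s_1, and apply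
the maximal volume bound. -/
theorem sv_perpMap_one_sq_mul_le {k : ℕ} (hk : 1 ≤ k) (B : GL (Fin d) ℝ)
    (F : PF d (k - 1) (k + 1)) {u : ι → EuclideanSpace ℝ (Fin d)} (hu : Orthonormal ℝ u)
    (hspan : Submodule.span ℝ (Set.range u) = F.lo) :
    (Matrix.gram ℝ fun a => lin B (u a)).det * sv (perpMap B F) 1 ^ 2 ≤
      ∏ i ∈ Finset.range (Fintype.card ι + 1), sv (lin B) (i + 1) ^ 2 := by
  have hd := (sv_of_plane (perpMap B F) (F.planeBasis_orthonormal hk)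
      (perpMap_eq_plane B F (F.planeBasis hk))).1
  have hs := (sv_perpMap_pos hk B F).1
  set x : EuclideanSpace ℝ (Fin d) := svBasis (perpMap B F) ⟨0, by omega⟩ with hx
  have hTx : ‖perpMap B F x‖ = sv (perpMap B F) 1 := norm_map_svBasis _ _
  -- The singular vector is not known to lie in the plane. Its projection has the same image and
  -- norm at most 1, so normalizing can only lengthen the image.
  set y := F.diff.starProjection x with hy
  have hymem : y ∈ F.diff := F.diff.starProjection_apply_mem x
  have hTy : perpMap B F y = perpMap B F x := by
    rw [perpMap_of_mem B F hymem, perpMap_apply]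
  have hy0 : 0 < ‖y‖ := by
    rw [norm_pos_iff]
    intro h
    rw [← hTx, ← hTy, h, map_zero, norm_zero] at hs
    exact lt_irrefl _ hs
  have hy1 : ‖y‖ ≤ 1 := by
    refine (F.diff.norm_starProjection_apply_le x).trans ?_
    rw [hx, OrthonormalBasis.norm_eq_one]
  set w : Fin 1 → EuclideanSpace ℝ (Fin d) := fun _ => ‖y‖⁻¹ • y with hw
  have hwmem (a) : w a ∈ F.diff := F.diff.smul_mem _ hymem
  have hwo : Orthonormal ℝ w := by
    refine ⟨fun a => ?_, fun a b hab => absurd (Subsingleton.elim a b) hab⟩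
    rw [hw, norm_smul, norm_inv, norm_norm, inv_mul_cancel₀ hy0.ne']
  have h := det_gram_map_le (lin B) (orthonormal_sumElim F hu hspan hwo hwmem)
  rw [det_gram_map_sumElim B F hspan hwmem, Fintype.card_sum, Fintype.card_fin,
    Matrix.det_fin_one, Matrix.gram_apply, real_inner_self_eq_norm_sq] at h
  refine le_trans (mul_le_mul_of_nonneg_left ?_ (Matrix.posSemidef_gram ℝ _).det_nonneg) h
  refine pow_le_pow_left₀ hs.le ?_ 2
  rw [hw, map_smul, hTy, norm_smul, norm_inv, norm_norm, hTx]
  exact le_mul_of_one_le_left hs.le ((one_le_inv₀ hy0).mpr hy1)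

end Deterministic

/-! ### Columns of an orthogonal matrix in singular coordinates -/

section Columns

variable {d : ℕ}

/-- The columns of an orthogonal matrix. -/
def col (U : Matrix.orthogonalGroup (Fin d) ℝ) (a : Fin d) : EuclideanSpace ℝ (Fin d) :=
  lin (Unitary.toUnits U) (EuclideanSpace.single a 1)

theorem col_apply (U : Matrix.orthogonalGroup (Fin d) ℝ) (a i : Fin d) : col U a i = U.1 i a := by
  simp [col, lin, Matrix.toEuclideanLin]

theorem orthonormal_col (U : Matrix.orthogonalGroup (Fin d) ℝ) : Orthonormal ℝ (col U) := by
  have hU : U.1.transpose * U.1 = 1 := (Matrix.mem_orthogonalGroup_iff' (Fin d) ℝ).mp U.2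
  rw [← Matrix.gram_eq_one_iff_orthonormal (𝕜 := ℝ), ← hU]
  ext a b
  simp only [Matrix.gram_apply, PiLp.inner_apply, col_apply, Matrix.mul_apply,
    Matrix.transpose_apply]
  simp [mul_comm]

/-- The orthogonal matrix whose rows are the right singular vectors. -/
def svMatrix (T : EuclideanSpace ℝ (Fin d) →ₗ[ℝ] EuclideanSpace ℝ (Fin d)) :
    Matrix.orthogonalGroup (Fin d) ℝ :=
  ⟨Matrix.of fun i j => svBasis T i j, by
    rw [Matrix.mem_orthogonalGroup_iff]
    rw [← Matrix.gram_eq_one_iff_orthonormal.mpr (svBasis T).orthonormal]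
    ext a b
    simp [Matrix.mul_apply, Matrix.gram_apply, PiLp.inner_apply, mul_comm]⟩

/-- Passing to singular coordinates multiplies U on the left by an orthogonal matrix. The singular
basis thus enters only through a translation that preserves Haar measure. -/
theorem det_svCoord_col (T : EuclideanSpace ℝ (Fin d) →ₗ[ℝ] EuclideanSpace ℝ (Fin d))
    {ι : Type*} [Fintype ι] [DecidableEq ι] (e f : ι → Fin d)
    (U : Matrix.orthogonalGroup (Fin d) ℝ) :
    ((svCoord T fun a => col U (e a)).submatrix f id).det = minor e f (svMatrix T * U) := by
  rw [minor]
  congr 1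
  ext a b
  simp [svCoord, svMatrix, Matrix.mul_apply, PiLp.inner_apply, col_apply, mul_comm]

end Columns

/-! ### Comparison of the gaps and existence of the constant -/

section Gap

variable {d : ℕ}

/-- The embedding of the first `m + n` indices, split into the first `m` and the next `n`. -/
def idx {m n : ℕ} (h : m + n ≤ d) : Fin m ⊕ Fin n → Fin d := Fin.castLE h ∘ finSumFinEquiv

theorem idx_injective {m n : ℕ} (h : m + n ≤ d) : Function.Injective (idx h) :=
  (Fin.castLE_injective h).comp finSumFinEquiv.injective

/-- The squared volume of the image under `B` of the cube spanned by the first columns of `U`. -/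
def volSq (B : GL (Fin d) ℝ) {m n : ℕ} (h : m + n ≤ d) (U : Matrix.orthogonalGroup (Fin d) ℝ) : ℝ :=
  (Matrix.gram ℝ fun a => lin B (col U (idx h a))).det

/-- The largest value of `volSq`. -/
def svProd (B : GL (Fin d) ℝ) (m : ℕ) : ℝ := ∏ i ∈ Finset.range m, sv (lin B) (i + 1) ^ 2

theorem svProd_pos (B : GL (Fin d) ℝ) {m : ℕ} (h : m ≤ d) : 0 < svProd B m :=
  Finset.prod_pos fun i hi => pow_pos (sv_lin_pos B (by omega)
    (by have := Finset.mem_range.mp hi; omega)) 2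

theorem log_svProd_succ (B : GL (Fin d) ℝ) {m : ℕ} (h : m + 1 ≤ d) :
    Real.log (svProd B (m + 1)) = Real.log (svProd B m) + 2 * Real.log (sv (lin B) (m + 1)) := by
  have h1 : svProd B (m + 1) = svProd B m * sv (lin B) (m + 1) ^ 2 := Finset.prod_range_succ _ _
  rw [h1, Real.log_mul (svProd_pos B (by omega)).ne'
    (pow_pos (sv_lin_pos B (by omega) h) 2).ne', Real.log_pow]
  norm_cast

theorem volSq_le (B : GL (Fin d) ℝ) {m n : ℕ} (h : m + n ≤ d)
    (U : Matrix.orthogonalGroup (Fin d) ℝ) : volSq B h U ≤ svProd B (m + n) := by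
  have h1 := det_gram_map_le (lin B) ((orthonormal_col U).comp _ (idx_injective h))
  rwa [Fintype.card_sum, Fintype.card_fin, Fintype.card_fin] at h1

/-- A bound for the defect of `log volSq`. -/
def volErr {m n : ℕ} (h : m + n ≤ d) (U : Matrix.orthogonalGroup (Fin d) ℝ) : ℝ :=
  Real.log (m + n).factorial - 2 * Real.log (minor (idx h) (idx h) U)

theorem le_volSq (B : GL (Fin d) ℝ) {m n : ℕ} (h : m + n ≤ d)
    (U : Matrix.orthogonalGroup (Fin d) ℝ) :
    svProd B (m + n) * minor (idx h) (idx h) (svMatrix (lin B) * U) ^ 2 ≤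
      (m + n).factorial * volSq B h U := by
  have h1 := le_factorial_mul_det_gram_map (lin B) (fun a => col U (idx h a)) (idx h)
  rw [det_svCoord_col, Fintype.card_sum, Fintype.card_fin, Fintype.card_fin] at h1
  have h2 : ∏ a, sv (lin B) ((idx h a : ℕ) + 1) ^ 2 = svProd B (m + n) := by
    rw [svProd, Finset.prod_range]
    exact finSumFinEquiv.prod_comp fun i : Fin (m + n) => sv (lin B) (i + 1) ^ 2
  rwa [h2] at h1

theorem log_volSq_mem (B : GL (Fin d) ℝ) {m n : ℕ} (h : m + n ≤ d)
    {U : Matrix.orthogonalGroup (Fin d) ℝ}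
    (hU : minor (idx h) (idx h) (svMatrix (lin B) * U) ≠ 0) :
    0 < volSq B h U ∧ Real.log (volSq B h U) ∈ Set.Icc
      (Real.log (svProd B (m + n)) - volErr h (svMatrix (lin B) * U))
      (Real.log (svProd B (m + n))) := by
  have hle := le_volSq B h U
  have hS := svProd_pos B h
  have hM := pow_pos (abs_pos.mpr hU) 2
  rw [sq_abs] at hM
  have hfac : (0 : ℝ) < (m + n).factorial := by positivity
  have hV : 0 < volSq B h U := pos_of_mul_pos_right ((mul_pos hS hM).trans_le hle) hfac.le
  refine ⟨hV, ?_, Real.log_le_log hV (volSq_le B h U)⟩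
  have h1 := Real.log_le_log (mul_pos hS hM) hle
  rw [Real.log_mul hS.ne' hM.ne', Real.log_mul hfac.ne' hV.ne', Real.log_pow] at h1
  rw [volErr]
  push_cast at h1
  linarith

theorem span_col_eq {i j : ℕ} (hij : i ≤ j) (hjd : j ≤ d) (U : Matrix.orthogonalGroup (Fin d) ℝ) :
    Submodule.span ℝ (Set.range fun a : Fin i => col U (Fin.castLE (hij.trans hjd) a)) =
      (PF.act (Unitary.toUnits U) (coordFlag hij hjd)).lo := by
  change _ = (coordSpace d i).map (lin (Unitary.toUnits U))
  rw [coordSpace, Submodule.map_span, ← Set.range_comp]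
  congr 1
  ext x
  constructor
  · rintro ⟨a, rfl⟩
    exact ⟨⟨Fin.castLE (hij.trans hjd) a, a.2⟩, rfl⟩
  · rintro ⟨⟨a, ha⟩, rfl⟩
    exact ⟨⟨a, ha⟩, rfl⟩

theorem col_mem_diff {i j : ℕ} (hij : i ≤ j) (hjd : j ≤ d) (U : Matrix.orthogonalGroup (Fin d) ℝ)
    {a : Fin d} (hi : i ≤ a) (hj : a < j) :
    col U a ∈ (PF.act (Unitary.toUnits U) (coordFlag hij hjd)).diff := by
  refine ⟨Submodule.mem_map_of_mem (Submodule.subset_span ⟨⟨a, hj⟩, rfl⟩), ?_⟩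
  rw [← span_col_eq]
  refine Submodule.mem_span_singleton_self (col U a) |> Submodule.isOrtho_iff_le.mp
    (Submodule.isOrtho_span.mpr ?_)
  rintro _ rfl _ ⟨b, rfl⟩
  exact (orthonormal_col U).2 fun h => by
    have := b.2
    have h' := congrArg Fin.val h
    rw [Fin.val_castLE] at h'
    omega

/-- Used for n = 0, 1, 2, where the second factor is 1, the squared length of the image of one
column, and s_1² s_2². -/
theorem volSq_eq {k : ℕ} (hkd : k < d) (B : GL (Fin d) ℝ)
    (U : Matrix.orthogonalGroup (Fin d) ℝ) {n : ℕ} (h : k - 1 + n ≤ d) (hn : k - 1 + n ≤ k + 1) :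
    volSq B h U =
      (Matrix.gram ℝ fun a : Fin (k - 1) => lin B (col U (Fin.castLE (by omega) a))).det *
      (Matrix.gram ℝ fun a : Fin n => perpMap B
        (PF.act (Unitary.toUnits U) (coordFlag (pred_le_succ k) hkd))
          (col U (idx h (Sum.inr a)))).det := by
  rw [← det_gram_map_sumElim B _ (span_col_eq (pred_le_succ k) hkd U), volSq]
  · congr 2
    funext a
    cases a <;> rfl
  · intro a
    have ha := a.2
    refine col_mem_diff _ _ U ?_ ?_
    · simp [idx]
    · simp [idx]; omega

/-- The logarithmic gap of `B` on the plane of a random flag. -/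
def flagGap {k : ℕ} (B : GL (Fin d) ℝ) (F : PF d (k - 1) (k + 1)) : ℝ :=
  Real.log (sv (perpMap B F) 1 / sv (perpMap B F) 2)

/-- With p_m and S_m as in the introduction and E_m the corresponding `volErr`, the difference lies
between −E_k and (E_{k-1} + E_{k+1})/2. The nonempty intervals of `log_volSq_mem` force E_m ≥ 0, so
the sum of the errors suffices. -/
theorem abs_flagGap_sub_le {k : ℕ} (hk : 1 ≤ k) (hkd : k < d) (B : GL (Fin d) ℝ)
    (h0 : k - 1 + 0 ≤ d) (h1 : k - 1 + 1 ≤ d) (h2 : k - 1 + 2 ≤ d)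
    {U : Matrix.orthogonalGroup (Fin d) ℝ}
    (hU0 : minor (idx h0) (idx h0) (svMatrix (lin B) * U) ≠ 0)
    (hU1 : minor (idx h1) (idx h1) (svMatrix (lin B) * U) ≠ 0)
    (hU2 : minor (idx h2) (idx h2) (svMatrix (lin B) * U) ≠ 0) :
    |flagGap B (PF.act (Unitary.toUnits U) (coordFlag (pred_le_succ k) hkd)) -
        Real.log (sv (lin B) k / sv (lin B) (k + 1))| ≤
      volErr h0 (svMatrix (lin B) * U) + volErr h1 (svMatrix (lin B) * U) +
        volErr h2 (svMatrix (lin B) * U) := by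
  set F := PF.act (Unitary.toUnits U) (coordFlag (pred_le_succ k) hkd) with hF
  obtain ⟨hV0, hlo0, hup0⟩ := log_volSq_mem B h0 hU0
  obtain ⟨hV1, hlo1, hup1⟩ := log_volSq_mem B h1 hU1
  obtain ⟨hV2, hlo2, hup2⟩ := log_volSq_mem B h2 hU2
  obtain ⟨hs1, hs2⟩ := sv_perpMap_pos hk B F
  have e0 := volSq_eq hkd B U h0 (by omega)
  have e1 := volSq_eq hkd B U h1 (by omega)
  have e2 := volSq_eq hkd B U h2 (by omega)
  rw [← hF] at e0 e1 e2
  -- The empty Gram determinant is 1, so the common base factor is the volume of the first k − 1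
  -- columns.
  rw [Matrix.det_fin_zero, mul_one] at e0
  rw [← e0] at e1 e2
  have hdm (a : Fin 2) : col U (idx h2 (Sum.inr a)) ∈ F.diff := by
    have ha := a.2
    refine col_mem_diff _ _ U ?_ ?_
    · simp [idx]
    · simp [idx]; omega
  have hon : Orthonormal ℝ fun a : Fin 2 => col U (idx h2 (Sum.inr a)) :=
    (orthonormal_col U).comp _ ((idx_injective h2).comp Sum.inr_injective)
  obtain ⟨b, hb⟩ := exists_planeBasis hk F hon hdm
  have hpl := perpMap_eq_plane B F b
  simp only [hb] at hpl
  have hs12 := (sv_of_plane (perpMap B F) hon hpl).2.2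
  rw [Matrix.det_fin_two] at e2
  simp only [Matrix.gram_apply, real_inner_self_eq_norm_sq] at e2
  rw [real_inner_comm (perpMap B F (col U (idx h2 (Sum.inr 0)))), ← sq, ← hs12] at e2
  rw [Matrix.det_fin_one, Matrix.gram_apply, real_inner_self_eq_norm_sq] at e1
  have i1 : volSq B h1 U ≤ volSq B h0 U * sv (perpMap B F) 1 ^ 2 := by
    rw [e1]
    refine mul_le_mul_of_nonneg_left (pow_le_pow_left₀ (norm_nonneg _) ?_ 2) hV0.le
    refine (norm_map_le _ _).trans_eq ?_
    rw [(orthonormal_col U).1, mul_one]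
  have i2 := sv_perpMap_one_sq_mul_le hk B F ((orthonormal_col U).comp _
    (Fin.castLE_injective (by omega : k - 1 ≤ d))) (span_col_eq (pred_le_succ k) hkd U)
  change (Matrix.gram ℝ fun a : Fin (k - 1) => lin B (col U (Fin.castLE _ a))).det * _ ≤ _ at i2
  rw [← e0, Fintype.card_fin, ← svProd] at i2
  have hq1 := pow_pos hs1 2
  have hq2 := pow_pos hs2 2
  have l2 := congrArg Real.log e2
  rw [Real.log_mul hV0.ne' (mul_pos hq1 hq2).ne', Real.log_mul hq1.ne' hq2.ne', Real.log_pow,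
    Real.log_pow] at l2
  have l1 := Real.log_le_log hV1 i1
  rw [Real.log_mul hV0.ne' hq1.ne', Real.log_pow] at l1
  have l3 := Real.log_le_log (mul_pos hV0 hq1) i2
  rw [Real.log_mul hV0.ne' hq1.ne', Real.log_pow] at l3
  have hk1 := sv_lin_pos B hk hkd.le
  have hk2 := sv_lin_pos B (show 1 ≤ k + 1 by omega) hkd
  have p1 := log_svProd_succ B (show k - 1 + 1 ≤ d by omega)
  have p2 := log_svProd_succ B (show k - 1 + 1 + 1 ≤ d by omega)
  rw [Nat.sub_add_cancel hk] at p1 p2 hup1 hlo1 l3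
  rw [show k - 1 + 2 = k + 1 by omega] at hlo2 hup2
  rw [add_zero] at hlo0 hup0
  rw [flagGap, Real.log_div hs1.ne' hs2.ne', Real.log_div hk1.ne' hk2.ne', abs_le]
  push_cast at l1 l2 l3
  constructor <;> linarith

theorem integrable_volErr {m n : ℕ} (h : m + n ≤ d) : Integrable (volErr h) (haarO d) :=
  (integrable_const _).sub ((integrable_log_minor (idx_injective h) (idx_injective h)).const_mul 2)

theorem map_mul_left_haarO (L : Matrix.orthogonalGroup (Fin d) ℝ) : (haarO d).map (fun U => L * U) = haarO d :=
  map_mul_left_eq_self (haarO d) L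

theorem measurable_mul_left_orthogonal (L : Matrix.orthogonalGroup (Fin d) ℝ) : Measurable (fun U => L * U) :=
  (continuous_const.mul continuous_id).measurable

theorem integrable_comp_mul_left_haarO {f : Matrix.orthogonalGroup (Fin d) ℝ → ℝ}
    (hf : Integrable f (haarO d)) (L : Matrix.orthogonalGroup (Fin d) ℝ) :
    Integrable (fun U => f (L * U)) (haarO d) := by
  rw [← map_mul_left_haarO L] at hf
  exact hf.comp_measurable (measurable_mul_left_orthogonal L)

theorem integral_comp_mul_left_haarO (f : Matrix.orthogonalGroup (Fin d) ℝ → ℝ)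
    (L : Matrix.orthogonalGroup (Fin d) ℝ) :
    ∫ U, f (L * U) ∂(haarO d) = ∫ U, f U ∂(haarO d) :=
  integral_mul_left_eq_self f L

theorem ae_comp_mul_left_haarO {p : Matrix.orthogonalGroup (Fin d) ℝ → Prop}
    (hp : ∀ᵐ U ∂(haarO d), p U) (L : Matrix.orthogonalGroup (Fin d) ℝ) :
    ∀ᵐ U ∂(haarO d), p (L * U) := by
  rw [← map_mul_left_haarO L] at hp
  exact ae_of_ae_map (measurable_mul_left_orthogonal L).aemeasurable hp

theorem ae_minor_mul_ne_zero {m n : ℕ} (h : m + n ≤ d) (L : Matrix.orthogonalGroup (Fin d) ℝ) :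
    ∀ᵐ U ∂(haarO d), minor (idx h) (idx h) (L * U) ≠ 0 :=
  ae_comp_mul_left_haarO (ae_minor_ne_zero (idx_injective h) (idx_injective h)) L

theorem integrable_map_and_abs_integral_sub_le {Ω X : Type*} [MeasurableSpace Ω]
    [MeasurableSpace X] {μ : Measure Ω} [IsProbabilityMeasure μ] {φ : Ω → X} (hφ : Measurable φ)
    {g : X → ℝ} (hg : Measurable g) {R : Ω → ℝ} (hR : Integrable R μ) {c : ℝ}
    (h : ∀ᵐ ω ∂μ, |g (φ ω) - c| ≤ R ω) :
    Integrable g (μ.map φ) ∧ |∫ x, g x ∂(μ.map φ) - c| ≤ ∫ ω, R ω ∂μ := by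
  have hsub : Integrable (fun ω => g (φ ω) - c) μ :=
    hR.mono' ((hg.comp hφ).sub_const c).aestronglyMeasurable h
  have hint : Integrable (fun ω => g (φ ω)) μ :=
    (hsub.add (integrable_const c)).congr (.of_forall fun ω => sub_add_cancel _ c)
  refine ⟨(integrable_map_measure hg.aestronglyMeasurable hφ.aemeasurable).mpr hint, ?_⟩
  have hconst : ∫ ω, (g (φ ω) - c) ∂μ = ∫ ω, g (φ ω) ∂μ - c := by
    rw [integral_sub hint (integrable_const c), integral_const, probReal_univ, one_smul]
  rw [integral_map hφ.aemeasurable hg.aestronglyMeasurable, ← hconst, ← Real.norm_eq_abs]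
  exact norm_integral_le_of_norm_le hR h

theorem measurable_flagGap {k : ℕ} (hk : 1 ≤ k) (hkd : k < d) (B : GL (Fin d) ℝ) :
    Measurable fun F : PF d (k - 1) (k + 1) => flagGap B F := by
  have h : Measurable fun F : PF d (k - 1) (k + 1) => (B, F) := measurable_prodMk_left
  have h1 := (measurable_sv_div_perpMap hk hkd).comp h
  exact h1.log

/-- The error for B is a fixed function of `svMatrix (lin B) * U`; left invariance makes its Haar
mean the same for every B. -/
theorem exists_flagGap_bound {k : ℕ} (hk : 1 ≤ k) (hkd : k < d) : ∃ C : ℝ, ∀ B : GL (Fin d) ℝ,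
    Integrable (fun F => flagGap B F) (haarPF (pred_le_succ k) hkd) ∧
      |∫ F, flagGap B F ∂(haarPF (pred_le_succ k) hkd) -
        Real.log (sv (lin B) k / sv (lin B) (k + 1))| ≤ C := by
  have h0 : k - 1 + 0 ≤ d := by omega
  have h1 : k - 1 + 1 ≤ d := by omega
  have h2 : k - 1 + 2 ≤ d := by omega
  have hR : Integrable (fun U => volErr h0 U + volErr h1 U + volErr h2 U) (haarO d) :=
    ((integrable_volErr h0).add (integrable_volErr h1)).add (integrable_volErr h2)
  refine ⟨∫ U, (volErr h0 U + volErr h1 U + volErr h2 U) ∂(haarO d), fun B => ?_⟩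
  have hae : ∀ᵐ U ∂(haarO d),
      |flagGap B (PF.act (Unitary.toUnits U) (coordFlag (pred_le_succ k) hkd)) -
        Real.log (sv (lin B) k / sv (lin B) (k + 1))| ≤
      volErr h0 (svMatrix (lin B) * U) + volErr h1 (svMatrix (lin B) * U) +
        volErr h2 (svMatrix (lin B) * U) := by
    filter_upwards [ae_minor_mul_ne_zero h0 (svMatrix (lin B)),
      ae_minor_mul_ne_zero h1 (svMatrix (lin B)),
      ae_minor_mul_ne_zero h2 (svMatrix (lin B))] with U hU0 hU1 hU2
    exact abs_flagGap_sub_le hk hkd B h0 h1 h2 hU0 hU1 hU2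
  rw [← integral_comp_mul_left_haarO _ (svMatrix (lin B))]
  exact integrable_map_and_abs_integral_sub_le (measurable_orbit _) (measurable_flagGap hk hkd B)
    (integrable_comp_mul_left_haarO hR (svMatrix (lin B))) hae

theorem exists_isGapConstant (d : ℕ) : ∃ C : ℝ, IsGapConstant d C := by
  have hex (k : Fin d) : ∃ C : ℝ, 1 ≤ (k : ℕ) → ∀ B : GL (Fin d) ℝ,
      Integrable (fun F => flagGap B F) (haarPF (pred_le_succ k) k.2) ∧
      |∫ F, flagGap B F ∂(haarPF (pred_le_succ k) k.2) -
        Real.log (sv (lin B) k / sv (lin B) (k + 1))| ≤ C := by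
    by_cases hk : 1 ≤ (k : ℕ)
    · obtain ⟨C, hC⟩ := exists_flagGap_bound hk k.2
      exact ⟨C, fun _ => hC⟩
    · exact ⟨0, fun h => absurd h hk⟩
  choose C hC using hex
  -- There are finitely many k, and the sum of absolute values dominates each of the constants.
  refine ⟨∑ k, |C k|, fun k hk hkd B => ?_⟩
  obtain ⟨hi, hle⟩ := hC ⟨k, hkd⟩ hk B
  exact ⟨hi, hle.trans ((le_abs_self _).trans
    (Finset.single_le_sum (f := fun k => |C k|) (fun k _ => abs_nonneg _) (Finset.mem_univ _)))⟩

end Gap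

end Miniflag

end

theorem mainTheorem6 (d : ℕ) :
    (∃ C : ℝ, Miniflag.IsGapConstant d C) ∧
    ∀ C : ℝ, Miniflag.IsGapConstant d C →
      ∀ (k : ℕ) (_ : 1 ≤ k) (hkd : k < d) (μ : Measure (GL (Fin d) ℝ)) [IsProbabilityMeasure μ],
        ∫⁻ F : Miniflag.PF d (k - 1) (k + 1), Miniflag.hFA F μ
            ∂(Miniflag.haarPF (Miniflag.pred_le_succ k) hkd) ≤
          ∫⁻ A, ENNReal.ofReal (Real.log (Miniflag.sv (Miniflag.lin A) k) -
            Real.log (Miniflag.sv (Miniflag.lin A) (k + 1))) ∂μ + ENNReal.ofReal C := by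
  refine ⟨Miniflag.exists_isGapConstant d, fun C hC k hk hkd μ _ => ?_⟩
  exact Miniflag.lintegral_hFA_le hC hk hkd μ fun A =>
    ⟨Miniflag.sv_lin_pos A hk hkd.le, Miniflag.sv_lin_pos A (Nat.le_add_left 1 k) hkd⟩
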